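/- Let $G=(V,E)$ be a finite simple undirected graph and let $c:V\to[\ell]=\{1,\dots,\ell\}$ be a coloring. A vertex $v$ is happy with respect to $c$ if $c(u)=c(v)$ for all neighbors $u$ of $v$; an edge $\{u,v\}$ is happy if $c(u)=c(v)$. An instance of \textsc{Max Happy Vertices} (respectively \textsc{Max Happy Edges}) consists of a graph $G=(V,E)$, a number $\ell$ of colors, a partial coloring $p:S\to[\ell]$ for some $S\subseteq V$, and a positive integer $k$. The question is whether there is a coloring $c:V\to[\ell]$ that extends $p$ and with respect to which $G$ has at least $k$ happy vertices (respectively at least $k$ happy edges). \textbf{Theorem.} \textsc{Max Happy Vertices} and \textsc{Max Happy Edges} are both fixed-parameter tractable when parameterized by the vertex cover number $d$ of the input graph $G$ (the minimum size of a vertex cover). That is, for each of the two problems there are a computable function $f:\mathbb{N}\to\mathbb{N}$, a constant $e$, and an algorithm (a program of a random access machine with addition and truncated subtraction, under the uniform cost measure) which, given any instance $I=(G,\ell,p,k)$ (with the numbers $\ell$, $k$ and the colors written in binary, and $G$ given by its adjacency matrix), decides it in at most $f(d)\cdot|I|^{e}$ steps, where $|I|$ is the bit length of the instance. The function $f$ depends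 on $d$ only; in particular the running time depends at most polynomially on $\ell$. -/

import Mathlib

namespace HappyColoring

/-! ### Random access machines with uniform cost -/

/-- Programs of a random access machine. The machine has registers `r 0, r 1, …` and memory banks
`m 0, m 1, …`, each of them an unbounded array, addressed indirectly; every register and every cell
holds a natural number. A program mentions only finitely many registers and banks.
The only arithmetic is addition and truncated subtraction (no multiplication), so that the
uniform cost measure below is polynomially related to the running time of Turing machines. -/
inductive Cmd : Type
  /-- do nothing -/
  | skip : Cmd
  /-- `r i := n` -/
  | const (i n : ℕ) : Cmd
  /-- `r i := r j + r k` -/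
  | add (i j k : ℕ) : Cmd
  /-- `r i := r j - r k`, or `0` if `r j < r k` -/
  | sub (i j k : ℕ) : Cmd
  /-- `r i := m a [r j]` -/
  | load (i a j : ℕ) : Cmd
  /-- `m a [r i] := r j` -/
  | store (a i j : ℕ) : Cmd
  /-- first `c₁`, then `c₂` -/
  | seq (c₁ c₂ : Cmd) : Cmd
  /-- if `r i ≠ 0` then `c₁` else `c₂` -/
  | ite (i : ℕ) (c₁ c₂ : Cmd) : Cmd
  /-- while `r i ≠ 0` do `c` -/
  | loop (i : ℕ) (c : Cmd) : Cmd

/-- Contents of the registers and of the memory banks. -/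
structure State : Type where
  reg : ℕ → ℕ
  mem : ℕ → ℕ → ℕ

/-- Write `x` into register `i`. -/
def State.setReg (s : State) (i x : ℕ) : State :=
  { s with reg := Function.update s.reg i x }

/-- Write `x` into cell `j` of bank `a`. -/
def State.setMem (s : State) (a j x : ℕ) : State :=
  { s with mem := Function.update s.mem a (Function.update (s.mem a) j x) }

/-- `Exec c s t s'`: started in `s`, the program `c` halts in `s'` after exactly `t` steps. Every
elementary instruction and every test of a conditional or of a loop is one step. -/
inductive Exec : Cmd → State → ℕ → State → Prop
  | skip (s : State) : Exec .skip s 1 s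
  | const (i n : ℕ) (s : State) : Exec (.const i n) s 1 (s.setReg i n)
  | add (i j k : ℕ) (s : State) : Exec (.add i j k) s 1 (s.setReg i (s.reg j + s.reg k))
  | sub (i j k : ℕ) (s : State) : Exec (.sub i j k) s 1 (s.setReg i (s.reg j - s.reg k))
  | load (i a j : ℕ) (s : State) : Exec (.load i a j) s 1 (s.setReg i (s.mem a (s.reg j)))
  | store (a i j : ℕ) (s : State) : Exec (.store a i j) s 1 (s.setMem a (s.reg i) (s.reg j))
  | seq {c₁ c₂ : Cmd} {s s₁ s₂ : State} {t₁ t₂ : ℕ} :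
      Exec c₁ s t₁ s₁ → Exec c₂ s₁ t₂ s₂ → Exec (.seq c₁ c₂) s (t₁ + t₂) s₂
  | ite_true {i : ℕ} {c₁ c₂ : Cmd} {s s' : State} {t : ℕ} :
      s.reg i ≠ 0 → Exec c₁ s t s' → Exec (.ite i c₁ c₂) s (t + 1) s'
  | ite_false {i : ℕ} {c₁ c₂ : Cmd} {s s' : State} {t : ℕ} :
      s.reg i = 0 → Exec c₂ s t s' → Exec (.ite i c₁ c₂) s (t + 1) s'
  | loop_exit {i : ℕ} {c : Cmd} {s : State} :
      s.reg i = 0 → Exec (.loop i c) s 1 s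
  | loop_step {i : ℕ} {c : Cmd} {s s₁ s₂ : State} {t₁ t₂ : ℕ} :
      s.reg i ≠ 0 → Exec c s t₁ s₁ → Exec (.loop i c) s₁ t₂ s₂ →
        Exec (.loop i c) s (t₁ + t₂ + 1) s₂

/-- The machine is deterministic: result and running time are determined by program and input. -/
theorem Exec.det {c : Cmd} {s s₁ s₂ : State} {t₁ t₂ : ℕ}
    (h₁ : Exec c s t₁ s₁) (h₂ : Exec c s t₂ s₂) : t₁ = t₂ ∧ s₁ = s₂ := by
  induction h₁ generalizing t₂ s₂ with
  | seq _ _ ih₁ ih₂ =>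
    cases h₂ with
    | seq a b =>
      obtain ⟨rfl, rfl⟩ := ih₁ a
      obtain ⟨rfl, rfl⟩ := ih₂ b
      exact ⟨rfl, rfl⟩
  | ite_true h _ ih =>
    cases h₂ with
    | ite_true _ b => obtain ⟨rfl, rfl⟩ := ih b; exact ⟨rfl, rfl⟩
    | ite_false g _ => exact absurd g h
  | ite_false h _ ih =>
    cases h₂ with
    | ite_true g _ => exact absurd h g
    | ite_false _ b => obtain ⟨rfl, rfl⟩ := ih b; exact ⟨rfl, rfl⟩
  | loop_exit h =>
    cases h₂ with
    | loop_exit _ => exact ⟨rfl, rfl⟩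
    | loop_step g _ _ => exact absurd h g
  | loop_step h _ _ ih₁ ih₂ =>
    cases h₂ with
    | loop_exit g => exact absurd g h
    | loop_step _ a b =>
      obtain ⟨rfl, rfl⟩ := ih₁ a
      obtain ⟨rfl, rfl⟩ := ih₂ b
      exact ⟨rfl, rfl⟩
  | _ => cases h₂; exact ⟨rfl, rfl⟩

/-- The start state: the input word occupies the first cells of bank `0`, one number per cell; all
other cells and all registers are `0`. -/
def inputState (w : List ℕ) : State where
  reg := fun _ => 0
  mem := fun a j => if a = 0 then w.getD j 0 else 0

/-- The length of an input word in bits: all its numbers are written in binary, with one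
separator symbol for each number. -/
def bitLength (w : List ℕ) : ℕ :=
  (w.map fun x => Nat.size x + 1).sum

/-! ### Parameterized problems -/

/-- A parameterized decision problem: instances, their encoding as words over `ℕ`, the
yes-instances, and the parameter. -/
structure ParamProblem : Type 1 where
  Inst : Type
  encode : Inst → List ℕ
  yes : Inst → Prop
  param : Inst → ℕ

/-- Fixed-parameter tractability: a single program decides the problem (it always halts, with a
nonzero number in register `0` exactly on the yes-instances) within `f (κ) * |I| ^ e` steps, where
`κ` is the parameter and `|I|` the bit length of the instance, `f` is a computable function and `e`
a constant. The program is given neither the parameter nor a witness for it. -/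
def ParamProblem.FPT (P : ParamProblem) : Prop :=
  ∃ (c : Cmd) (f : ℕ → ℕ) (e : ℕ), Computable f ∧
    ∀ I : P.Inst, ∃ (t : ℕ) (s : State),
      Exec c (inputState (P.encode I)) t s ∧
      t ≤ f (P.param I) * bitLength (P.encode I) ^ e ∧
      (s.reg 0 ≠ 0 ↔ P.yes I)

/-! ### Happy colorings -/

/-- A vertex is happy with respect to `c` if all its neighbors have its color. -/
def happyVertices {V C : Type} (G : SimpleGraph V) (c : V → C) : Set V :=
  {v | ∀ u, G.Adj v u → c u = c v}

/-- An edge is happy with respect to `c` if its endpoints have the same color. -/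
def happyEdges {V C : Type} (G : SimpleGraph V) (c : V → C) : Set (Sym2 V) :=
  {e | e ∈ G.edgeSet ∧ ∀ u ∈ e, ∀ v ∈ e, c u = c v}

/-- An instance: a finite graph, a number `l` of colors, a partial coloring `p` of the vertices
with these colors (`none` means not precolored) and a positive integer `k`. -/
structure Instance : Type where
  n : ℕ
  G : SimpleGraph (Fin n)
  l : ℕ
  p : Fin n → Option (Fin l)
  k : ℕ
  k_pos : 0 < k

namespace Instance

/-- `c` extends the precoloring. -/
def Extends (I : Instance) (c : Fin I.n → Fin I.l) : Prop :=
  ∀ v j, I.p v = some j → c v = j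

/-- The input word: `n, l, k`, then for every vertex `0` if it is not precolored and `j + 1` if
it is precolored with the color `j ∈ {0, …, l - 1}`, then the adjacency matrix row by row. -/
noncomputable def encode (I : Instance) : List ℕ :=
  [I.n, I.l, I.k]
    ++ List.ofFn (fun v : Fin I.n => (I.p v).elim 0 fun j => (j : ℕ) + 1)
    ++ (List.ofFn fun u : Fin I.n => List.ofFn fun v : Fin I.n =>
        open Classical in if I.G.Adj u v then 1 else 0).flatten

/-- The minimum size of a vertex cover of the graph (finite, as the graph is finite). -/
noncomputable def vcNumber (I : Instance) : ℕ :=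
  I.G.vertexCoverNum.toNat

end Instance

/-- Max Happy Vertices, parameterized by the vertex cover number. -/
noncomputable def maxHappyVertices : ParamProblem where
  Inst := Instance
  encode := Instance.encode
  yes I := ∃ c : Fin I.n → Fin I.l, I.Extends c ∧ I.k ≤ (happyVertices I.G c).ncard
  param := Instance.vcNumber

/-- Max Happy Edges, parameterized by the vertex cover number. -/
noncomputable def maxHappyEdges : ParamProblem where
  Inst := Instance
  encode := Instance.encode
  yes I := ∃ c : Fin I.n → Fin I.l, I.Extends c ∧ I.k ≤ (happyEdges I.G c).ncard
  param := Instance.vcNumber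

end HappyColoring

/-! Fix a vertex cover `X` with `m` vertices. Up to the names of the colors, a coloring of `X` is a
partition of `X`, and partitions are given by at most `m ^ m` labellings. For a fixed labelling the
rest is greedy. All neighbors of a vertex outside `X` lie in `X`. If the vertex is not precolored,
it takes the color of the class with most of its neighbors. If it is precolored, it gains from a
class only through the color of that class, so the classes choose their colors independently. Two
classes may choose the same color: this only merges them and destroys no happiness already counted.
Hence two inequalities suffice: the partition induced by a coloring scores at least as much as the
coloring (`edgeScore_ge`), and every score that passes the tests is reached by some coloring
(`exists_edgeScore_le`). For happy vertices the set `H` of happy vertices inside `X` is guessed as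
well, with `2 ^ m` choices (`vertexScore_ge`, `exists_vertexScore_le`).

The number of colors does not enter the search: a color absent from the precoloring gains nothing
and is admissible only for a class without constraints, where any other color is as good
(`le_best`).

The program knows neither the vertex cover number `d` nor a cover. For every `t`, the vertices of
degree more than `t` and those with a neighbor of degree at most `t` together form a vertex cover.
For `t = d` it has at most `d * d + d` vertices, so raising `t` until the size is at most `t * t +
t` stops at some `t ≤ d` (`coverSize_vcNumber_le`, `threshold_iter`).

For the running time, the algorithms are written as expressions whose only loops are folds. If every
fold makes at most `N` rounds, the compiled code runs in time polynomial in `N`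
(`Expr.compile_correct`). Here `N` is a function of `d` times the bit length: labellings and sets
are searched as numbers below `m ^ m` and `2 ^ m`, read digit by digit (`exists_code`). -/

namespace HappyColoring

/-! ### A functional language for the random access machine -/

/-- Environments of de Bruijn variables: put `x` in front. -/
def push (x : ℕ) (ρ : ℕ → ℕ) : ℕ → ℕ
  | 0 => x
  | i + 1 => ρ i

@[simp] theorem push_zero (x : ℕ) (ρ : ℕ → ℕ) : push x ρ 0 = x := rfl
@[simp] theorem push_succ (x : ℕ) (ρ : ℕ → ℕ) (i : ℕ) : push x ρ (i + 1) = ρ i := rfl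
@[simp] theorem push_one (x : ℕ) (ρ : ℕ → ℕ) : push x ρ 1 = ρ 0 := rfl
@[simp] theorem push_two (x : ℕ) (ρ : ℕ → ℕ) : push x ρ 2 = ρ 1 := rfl
@[simp] theorem push_three (x : ℕ) (ρ : ℕ → ℕ) : push x ρ 3 = ρ 2 := rfl
@[simp] theorem push_four (x : ℕ) (ρ : ℕ → ℕ) : push x ρ 4 = ρ 3 := rfl

/-- Primitive recursion on the natural numbers, without parameters. -/
def iter (n a : ℕ) (f : ℕ → ℕ → ℕ) : ℕ :=
  Nat.rec a f n

@[simp] theorem iter_zero (a : ℕ) (f : ℕ → ℕ → ℕ) : iter 0 a f = a := rfl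
@[simp] theorem iter_succ (n a : ℕ) (f : ℕ → ℕ → ℕ) :
    iter (n + 1) a f = f n (iter n a f) := rfl

/-- Expressions over an input word: `get a` reads the cell `a` of the input, `bind a b` evaluates
`b` with the value of `a` as new variable `0`, and `fold n a b` iterates `b` as often as `n` says,
starting with `a`; in `b`, variable `0` is the loop index and variable `1` the accumulator.
`ren f a` renames the variables of `a`. -/
inductive Expr : Type
  | var (i : ℕ) : Expr
  | const (c : ℕ) : Expr
  | get (a : Expr) : Expr
  | add (a b : Expr) : Expr
  | sub (a b : Expr) : Expr
  | ite (c a b : Expr) : Expr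
  | bind (a b : Expr) : Expr
  | fold (n a b : Expr) : Expr
  | ren (f : ℕ → ℕ) (a : Expr) : Expr

namespace Expr

/-- The value of an expression, for an input word `W` and values `ρ` of the variables. -/
def eval (W : ℕ → ℕ) : Expr → (ℕ → ℕ) → ℕ
  | var i, ρ => ρ i
  | const c, _ => c
  | get a, ρ => W (a.eval W ρ)
  | add a b, ρ => a.eval W ρ + b.eval W ρ
  | sub a b, ρ => a.eval W ρ - b.eval W ρ
  | ite c a b, ρ => if c.eval W ρ ≠ 0 then a.eval W ρ else b.eval W ρ
  | bind a b, ρ => b.eval W (push (a.eval W ρ) ρ)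
  | fold n a b, ρ =>
      iter (n.eval W ρ) (a.eval W ρ) fun i x => b.eval W (push i (push x ρ))
  | ren f a, ρ => a.eval W fun i => ρ (f i)

/-- In the evaluation of the expression, every `fold` makes at most `N` rounds. -/
def Bdd (W : ℕ → ℕ) (N : ℕ) : Expr → (ℕ → ℕ) → Prop
  | var _, _ => True
  | const _, _ => True
  | get a, ρ => a.Bdd W N ρ
  | add a b, ρ => a.Bdd W N ρ ∧ b.Bdd W N ρ
  | sub a b, ρ => a.Bdd W N ρ ∧ b.Bdd W N ρ
  | ite c a b, ρ => c.Bdd W N ρ ∧ (c.eval W ρ ≠ 0 → a.Bdd W N ρ) ∧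
      (c.eval W ρ = 0 → b.Bdd W N ρ)
  | bind a b, ρ => a.Bdd W N ρ ∧ b.Bdd W N (push (a.eval W ρ) ρ)
  | fold n a b, ρ => n.Bdd W N ρ ∧ a.Bdd W N ρ ∧ n.eval W ρ ≤ N ∧
      ∀ i < n.eval W ρ,
        b.Bdd W N (push i (push (iter i (a.eval W ρ) fun i x => b.eval W (push i (push x ρ))) ρ))
  | ren f a, ρ => a.Bdd W N fun i => ρ (f i)

/-- Code that evaluates an expression. Variable `i` is kept in register `r i`, the result goes to
register `d`, and registers below `d` are not changed. -/
def compile : Expr → (ℕ → ℕ) → ℕ → Cmd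
  | var i, r, d => .seq (.const d 0) (.add d d (r i))
  | const c, _, d => .const d c
  | get a, r, d => .seq (a.compile r d) (.load d 0 d)
  | add a b, r, d => .seq (a.compile r d) (.seq (b.compile r (d + 1)) (.add d d (d + 1)))
  | sub a b, r, d => .seq (a.compile r d) (.seq (b.compile r (d + 1)) (.sub d d (d + 1)))
  | ite c a b, r, d => .seq (c.compile r d) (.ite d (a.compile r d) (b.compile r d))
  | bind a b, r, d => .seq (a.compile r d) (.seq (b.compile (push d r) (d + 1))
      (.seq (.const d 0) (.add d d (d + 1))))
  | fold n a b, r, d => .seq (n.compile r d) (.seq (a.compile r (d + 1)) (.seq (.const (d + 2) 0)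
      (.seq (.loop d (.seq (b.compile (push (d + 2) (push (d + 1) r)) (d + 3))
        (.seq (.const (d + 1) 0) (.seq (.add (d + 1) (d + 1) (d + 3))
          (.seq (.const (d + 3) 1) (.seq (.add (d + 2) (d + 2) (d + 3))
            (.sub d d (d + 3)))))))) (.add d d (d + 1)))))
  | ren f a, r, d => a.compile (fun i => r (f i)) d

/-- The constant factor in the running time of an expression. -/
def factor : Expr → ℕ
  | var _ => 2
  | const _ => 1
  | get a => a.factor + 1
  | add a b => a.factor + b.factor + 1
  | sub a b => a.factor + b.factor + 1
  | ite c a b => c.factor + a.factor + b.factor + 1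
  | bind a b => a.factor + b.factor + 2
  | fold n a b => n.factor + a.factor + b.factor + 9
  | ren _ a => a.factor

/-- The nesting depth of the loops in an expression, roughly. -/
def depth : Expr → ℕ
  | var _ => 0
  | const _ => 0
  | get a => a.depth
  | add a b => a.depth + b.depth
  | sub a b => a.depth + b.depth
  | ite c a b => c.depth + a.depth + b.depth
  | bind a b => a.depth + b.depth
  | fold n a b => n.depth + a.depth + b.depth + 1
  | ren _ a => a.depth

end Expr

/-! ### Correctness and running time of compiled expressions -/

@[simp] theorem State.setReg_reg (s : State) (i x j : ℕ) :
    (s.setReg i x).reg j = if j = i then x else s.reg j := by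
  simp [State.setReg, Function.update_apply]

@[simp] theorem State.setReg_mem (s : State) (i x : ℕ) : (s.setReg i x).mem = s.mem := rfl

/-- From state `s`, the program `c` halts within `T` steps in a state that has the same memory, the
same registers below `d` and value `x` in register `d`. -/
def Puts (c : Cmd) (s : State) (T d x : ℕ) : Prop :=
  ∃ (t : ℕ) (s' : State), Exec c s t s' ∧ t ≤ T ∧ s'.mem = s.mem ∧
    (∀ j < d, s'.reg j = s.reg j) ∧ s'.reg d = x

theorem pow_bound {N : ℕ} (hN : 1 ≤ N) {k e K D : ℕ} (hk : k ≤ K) (he : e ≤ D) :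
    k * N ^ e ≤ K * N ^ D :=
  Nat.mul_le_mul hk (Nat.pow_le_pow_right hN he)

/-- Induction on the expression. Variables lie below `d` and scratch registers at or above `d`, so a
subexpression spoils neither the environment nor earlier results, and the memory is never written.
The depths of subexpressions are added, so each partial cost is bounded by its own factor times the
common power of `N`. -/
theorem Expr.compile_correct {W : ℕ → ℕ} {N : ℕ} (hN : 1 ≤ N) (e : Expr) :
    ∀ (r : ℕ → ℕ) (d : ℕ) (ρ : ℕ → ℕ) (s : State), (∀ i, r i < d) → (∀ i, s.reg (r i) = ρ i) →
      s.mem 0 = W → e.Bdd W N ρ →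
      Puts (e.compile r d) s (e.factor * N ^ e.depth) d (e.eval W ρ) := by
  induction e with
  | var i =>
    intro r d ρ s hr hs hm _
    refine ⟨_, _, .seq (.const _ _ _) (.add _ _ _ _), by simp [factor, depth], rfl, ?_, ?_⟩
    · intro j hj
      simp [hj.ne]
    · simp [(hr i).ne, hs, eval]
  | const c =>
    intro r d ρ s hr hs hm _
    refine ⟨_, _, .const _ _ _, by simp [factor, depth], rfl, ?_, ?_⟩
    · intro j hj
      simp [hj.ne]
    · simp [eval]
  | get a iha =>
    intro r d ρ s hr hs hm hb
    obtain ⟨t, s', h, ht, hm', hj, hd⟩ := iha r d ρ s hr hs hm hb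
    refine ⟨_, _, .seq h (.load _ _ _ _), ?_, hm', ?_, ?_⟩
    · have : 1 ≤ N ^ a.depth := Nat.one_le_pow _ _ hN
      simp only [factor, depth, add_mul]
      omega
    · intro j hj'
      simp [hj'.ne, hj j hj']
    · simp [hm', hm, hd, eval]
  | add a b iha ihb =>
    intro r d ρ s hr hs hm hb
    obtain ⟨t, s', h, ht, hm', hj, hd⟩ := iha r d ρ s hr hs hm hb.1
    obtain ⟨t', s'', h', ht', hm'', hj', hd'⟩ := ihb r (d + 1) ρ s'
      (fun i => (hr i).trans d.lt_succ_self) (fun i => by rw [hj _ (hr i), hs]) (hm' ▸ hm) hb.2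
    refine ⟨_, _, .seq h (.seq h' (.add _ _ _ _)), ?_, hm''.trans hm', ?_, ?_⟩
    · have h1 : 1 ≤ N ^ (a.depth + b.depth) := Nat.one_le_pow _ _ hN
      have h2 := pow_bound hN (le_refl a.factor) (Nat.le_add_right a.depth b.depth)
      have h3 := pow_bound hN (le_refl b.factor) (Nat.le_add_left b.depth a.depth)
      simp only [factor, depth, add_mul]
      omega
    · intro j hjd
      simp [hjd.ne, hj j hjd, hj' j (hjd.trans d.lt_succ_self)]
    · simp [hj' d d.lt_succ_self, hd, hd', eval]
  | sub a b iha ihb =>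
    intro r d ρ s hr hs hm hb
    obtain ⟨t, s', h, ht, hm', hj, hd⟩ := iha r d ρ s hr hs hm hb.1
    obtain ⟨t', s'', h', ht', hm'', hj', hd'⟩ := ihb r (d + 1) ρ s'
      (fun i => (hr i).trans d.lt_succ_self) (fun i => by rw [hj _ (hr i), hs]) (hm' ▸ hm) hb.2
    refine ⟨_, _, .seq h (.seq h' (.sub _ _ _ _)), ?_, hm''.trans hm', ?_, ?_⟩
    · have h1 : 1 ≤ N ^ (a.depth + b.depth) := Nat.one_le_pow _ _ hN
      have h2 := pow_bound hN (le_refl a.factor) (Nat.le_add_right a.depth b.depth)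
      have h3 := pow_bound hN (le_refl b.factor) (Nat.le_add_left b.depth a.depth)
      simp only [factor, depth, add_mul]
      omega
    · intro j hjd
      simp [hjd.ne, hj j hjd, hj' j (hjd.trans d.lt_succ_self)]
    · simp [hj' d d.lt_succ_self, hd, hd', eval]
  | ite c a b ihc iha ihb =>
    intro r d ρ s hr hs hm hb
    obtain ⟨t, s', h, ht, hm', hj, hd⟩ := ihc r d ρ s hr hs hm hb.1
    have h1 : 1 ≤ N ^ (c.depth + a.depth + b.depth) := Nat.one_le_pow _ _ hN
    have h2 := pow_bound hN (le_refl c.factor)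
      (show c.depth ≤ c.depth + a.depth + b.depth by omega)
    have h3 := pow_bound hN (le_refl a.factor)
      (show a.depth ≤ c.depth + a.depth + b.depth by omega)
    have h4 := pow_bound hN (le_refl b.factor)
      (show b.depth ≤ c.depth + a.depth + b.depth by omega)
    by_cases hc : c.eval W ρ = 0
    · obtain ⟨t', s'', h', ht', hm'', hj', hd'⟩ := ihb r d ρ s' hr
        (fun i => by rw [hj _ (hr i), hs]) (hm' ▸ hm) (hb.2.2 hc)
      refine ⟨_, _, .seq h (.ite_false (hd.trans hc) h'), ?_, hm''.trans hm', ?_, ?_⟩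
      · simp only [factor, depth, add_mul]
        omega
      · intro j hjd
        rw [hj' j hjd, hj j hjd]
      · simp [hd', eval, hc]
    · obtain ⟨t', s'', h', ht', hm'', hj', hd'⟩ := iha r d ρ s' hr
        (fun i => by rw [hj _ (hr i), hs]) (hm' ▸ hm) (hb.2.1 hc)
      refine ⟨_, _, .seq h (.ite_true (hd ▸ hc) h'), ?_, hm''.trans hm', ?_, ?_⟩
      · simp only [factor, depth, add_mul]
        omega
      · intro j hjd
        rw [hj' j hjd, hj j hjd]
      · simp [hd', eval, hc]
  | bind a b iha ihb =>
    intro r d ρ s hr hs hm hb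
    obtain ⟨t, s', h, ht, hm', hj, hd⟩ := iha r d ρ s hr hs hm hb.1
    obtain ⟨t', s'', h', ht', hm'', hj', hd'⟩ := ihb (push d r) (d + 1)
      (push (a.eval W ρ) ρ) s'
      (fun i => by cases i with
        | zero => simp
        | succ i => exact (hr i).trans d.lt_succ_self)
      (fun i => by cases i with
        | zero => simpa using hd
        | succ i => simp [hj _ (hr i), hs])
      (hm' ▸ hm) hb.2
    refine ⟨_, _, .seq h (.seq h' (.seq (.const _ _ _) (.add _ _ _ _))), ?_, hm''.trans hm',
      ?_, ?_⟩
    · have h1 : 1 ≤ N ^ (a.depth + b.depth) := Nat.one_le_pow _ _ hN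
      have h2 := pow_bound hN (le_refl a.factor) (Nat.le_add_right a.depth b.depth)
      have h3 := pow_bound hN (le_refl b.factor) (Nat.le_add_left b.depth a.depth)
      simp only [factor, depth, add_mul]
      omega
    · intro j hjd
      simp [hjd.ne, hj j hjd, hj' j (hjd.trans d.lt_succ_self)]
    · simp [hd', eval]
  | fold n a b ihn iha ihb =>
    intro r d ρ s hr hs hm hb
    obtain ⟨hbn, hba, hnN, hbb⟩ := hb
    obtain ⟨t₁, s₁, h₁, ht₁, hm₁, hj₁, hd₁⟩ := ihn r d ρ s hr hs hm hbn
    obtain ⟨t₂, s₂, h₂, ht₂, hm₂, hj₂, hd₂⟩ := iha r (d + 1) ρ s₁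
      (fun i => (hr i).trans d.lt_succ_self) (fun i => by rw [hj₁ _ (hr i), hs]) (hm₁ ▸ hm) hba
    -- Loop invariant with `i` rounds done and `k` left: register `d` counts down, `d + 1` holds the
    -- accumulator and `d + 2` the index. A round costs its body, five instructions and one test.
    have key : ∀ k i (s' : State), i + k = n.eval W ρ → s'.mem = s.mem →
        (∀ j < d, s'.reg j = s.reg j) → s'.reg d = k →
        s'.reg (d + 1) = iter i (a.eval W ρ) (fun i x => b.eval W (push i (push x ρ))) →
        s'.reg (d + 2) = i →
        ∃ t s'', Exec (.loop d (.seq (b.compile (push (d + 2) (push (d + 1) r)) (d + 3))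
          (.seq (.const (d + 1) 0) (.seq (.add (d + 1) (d + 1) (d + 3))
            (.seq (.const (d + 3) 1) (.seq (.add (d + 2) (d + 2) (d + 3))
              (.sub d d (d + 3)))))))) s' t s'' ∧
          t ≤ k * (b.factor * N ^ b.depth + 6) + 1 ∧ s''.mem = s.mem ∧
          (∀ j < d, s''.reg j = s.reg j) ∧ s''.reg d = 0 ∧
          s''.reg (d + 1) = (fold n a b).eval W ρ := by
      intro k
      induction k with
      | zero =>
        intro i s' hi hm' hj' h0 hacc hix
        refine ⟨_, _, .loop_exit h0, by omega, hm', hj', h0, ?_⟩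
        rw [hacc, eval, ← hi, add_zero]
      | succ k ihk =>
        intro i s' hi hm' hj' h0 hacc hix
        obtain ⟨t₃, s₃, h₃, ht₃, hm₃, hj₃, hd₃⟩ := ihb (push (d + 2) (push (d + 1) r)) (d + 3)
          (push i (push (iter i (a.eval W ρ) fun i x => b.eval W (push i (push x ρ))) ρ)) s'
          (fun i => by
            rcases i with _ | _ | i
            · simp
            · simp
            · exact (hr i).trans (by omega))
          (fun i => by
            rcases i with _ | _ | i
            · simpa using hix
            · simpa using hacc
            · simp [hj' _ (hr i), hs])
          (by rw [hm', hm]) (hbb i (by omega))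
        obtain ⟨s₄, hx, hm₄, hj₄, h₀, h₁, h₂⟩ : ∃ s₄, Exec (.seq
            (b.compile (push (d + 2) (push (d + 1) r)) (d + 3))
            (.seq (.const (d + 1) 0) (.seq (.add (d + 1) (d + 1) (d + 3))
              (.seq (.const (d + 3) 1) (.seq (.add (d + 2) (d + 2) (d + 3))
                (.sub d d (d + 3))))))) s' (t₃ + 5) s₄ ∧ s₄.mem = s.mem ∧
            (∀ j < d, s₄.reg j = s.reg j) ∧ s₄.reg d = k ∧
            s₄.reg (d + 1) = s₃.reg (d + 3) ∧ s₄.reg (d + 2) = i + 1 := by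
          refine ⟨_, .seq h₃ (.seq (.const _ _ _) (.seq (.add _ _ _ _)
            (.seq (.const _ _ _) (.seq (.add _ _ _ _) (.sub _ _ _ _))))), ?_, ?_, ?_, ?_, ?_⟩
          · simp [hm₃, hm']
          · intro j hj
            have h0 : j ≠ d := by omega
            have h1 : j ≠ d + 1 := by omega
            have h2 : j ≠ d + 2 := by omega
            have h3 : j ≠ d + 3 := by omega
            simp [h0, h1, h2, h3, hj₃ j (by omega), hj' j hj]
          · simp [hj₃ d (by omega), h0]
          · simp
          · simp [hj₃ (d + 2) (by omega), hix]
        obtain ⟨t₄, s₅, h₄, ht₄, hm₅, hj₅, h0', hacc'⟩ := ihk (i + 1) s₄ (by omega) hm₄ hj₄ h₀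
          (by rw [h₁, hd₃, iter_succ]) h₂
        refine ⟨_, _, .loop_step (by omega) hx h₄, ?_, hm₅, hj₅, h0', hacc'⟩
        rw [add_mul]
        omega
    obtain ⟨t₃, s₃, h₃, ht₃, hm₃, hj₃, h0, hacc⟩ := key (n.eval W ρ) 0 (s₂.setReg (d + 2) 0)
      (by omega) (by simp [hm₂, hm₁])
      (fun j hj => by
        have h2 : j ≠ d + 2 := by omega
        simp [h2, hj₂ j (by omega), hj₁ j hj])
      (by simp [hj₂ d (by omega), hd₁]) (by simp [hd₂]) (by simp)
    -- The loop leaves `0` in register `d`, so the final addition moves the accumulator there.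
    refine ⟨_, _, .seq h₁ (.seq h₂ (.seq (.const _ _ _) (.seq h₃ (.add _ _ _ _)))), ?_, ?_, ?_, ?_⟩
    · have e1 : 1 ≤ N ^ (n.depth + a.depth + b.depth + 1) := Nat.one_le_pow _ _ hN
      have e2 := pow_bound hN (le_refl n.factor)
        (show n.depth ≤ n.depth + a.depth + b.depth + 1 by omega)
      have e3 := pow_bound hN (le_refl a.factor)
        (show a.depth ≤ n.depth + a.depth + b.depth + 1 by omega)
      have e4 : n.eval W ρ * (b.factor * N ^ b.depth + 6) ≤
          (b.factor + 6) * N ^ (n.depth + a.depth + b.depth + 1) := by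
        have h : b.factor * N ^ b.depth + 6 ≤ (b.factor + 6) * N ^ b.depth := by
          have : 1 ≤ N ^ b.depth := Nat.one_le_pow _ _ hN
          rw [add_mul]
          omega
        calc n.eval W ρ * (b.factor * N ^ b.depth + 6)
            ≤ N * ((b.factor + 6) * N ^ b.depth) := Nat.mul_le_mul hnN h
          _ = (b.factor + 6) * N ^ (b.depth + 1) := by ring
          _ ≤ _ := pow_bound hN le_rfl (by omega)
      simp only [factor, depth, add_mul] at e4 ⊢
      omega
    · simp [hm₃]
    · intro j hj
      simp [hj.ne, hj₃ j hj]
    · simp [h0, hacc]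
  | ren f a iha =>
    intro r d ρ s hr hs hm hb
    exact iha (fun i => r (f i)) d (fun i => ρ (f i)) s (fun i => hr _) (fun i => hs _) hm hb

/-! ### Bounded sums and maxima, logic and arithmetic as expressions -/

namespace Expr

/-- A nonzero value stands for truth. -/
def Holds (W : ℕ → ℕ) (a : Expr) (ρ : ℕ → ℕ) : Prop := a.eval W ρ ≠ 0

/-- Weakening: skip variable `0`. -/
def sh (a : Expr) : Expr := ren Nat.succ a

/-- The renaming keeps the loop index as variable `0` and hides the accumulator from `b`. -/
def sumE (n b : Expr) : Expr :=
  fold n (const 0) (add (var 1) (ren (push 0 fun i => i + 2) b))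

/-- With truncated subtraction, `x + (y - x)` is the maximum of `x` and `y`. -/
def maxE (n b : Expr) : Expr :=
  fold n (const 0) (add (var 1) (sub (ren (push 0 fun i => i + 2) b) (var 1)))

def notE (a : Expr) : Expr := ite a (const 0) (const 1)
def andE (a b : Expr) : Expr := ite a b (const 0)
def orE (a b : Expr) : Expr := ite a (const 1) b
def impE (a b : Expr) : Expr := ite a b (const 1)
def leE (a b : Expr) : Expr := notE (sub a b)
def eqE (a b : Expr) : Expr := andE (leE a b) (leE b a)
def oneIf (a : Expr) : Expr := ite a (const 1) (const 0)
def exE (n b : Expr) : Expr := sumE n b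
def allE (n b : Expr) : Expr := notE (exE n (notE b))
-- The left factor is the number of rounds, so a large number may stand on the right.
def mulE (a b : Expr) : Expr := sumE a (sh b)
-- The loops run over the exponent and the base, never over the possibly huge power.
def powE (a b : Expr) : Expr := fold b (const 1) (mulE (sh (sh a)) (var 1))
-- The quotient is the number of `q < a` with `(q + 1) * b ≤ a`. The outer test makes division by
-- `0` give `0`, as for `Nat`.
def divE (a b : Expr) : Expr :=
  ite b (sumE a (oneIf (leE (mulE (add (var 0) (const 1)) (sh b)) (sh a)))) (const 0)
def modE (a b : Expr) : Expr := sub a (mulE (divE a b) b)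

section
variable (W : ℕ → ℕ) (N : ℕ) (ρ : ℕ → ℕ) (a b c n : Expr)

@[simp] theorem eval_var (i : ℕ) : (var i).eval W ρ = ρ i := rfl
@[simp] theorem eval_const (i : ℕ) : (const i).eval W ρ = i := rfl
@[simp] theorem eval_get : (get a).eval W ρ = W (a.eval W ρ) := rfl
@[simp] theorem eval_add : (add a b).eval W ρ = a.eval W ρ + b.eval W ρ := rfl
@[simp] theorem eval_sub : (sub a b).eval W ρ = a.eval W ρ - b.eval W ρ := rfl
@[simp] theorem eval_bind : (bind a b).eval W ρ = b.eval W (push (a.eval W ρ) ρ) := rfl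
@[simp] theorem eval_sh (x : ℕ) : (sh a).eval W (push x ρ) = a.eval W ρ := rfl

@[simp] theorem Holds_get : (get a).Holds W ρ ↔ W (a.eval W ρ) ≠ 0 := Iff.rfl
@[simp] theorem Holds_bind : (bind a b).Holds W ρ ↔ b.Holds W (push (a.eval W ρ) ρ) := Iff.rfl

open Classical in
@[simp] theorem eval_ite : (ite c a b).eval W ρ =
    if c.Holds W ρ then a.eval W ρ else b.eval W ρ := by
  rw [eval]
  unfold Holds
  congr

variable {W N ρ a b c n}

theorem Bdd_ite (hc : c.Bdd W N ρ) (ha : a.Bdd W N ρ) (hb : b.Bdd W N ρ) :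
    (ite c a b).Bdd W N ρ :=
  ⟨hc, fun _ => ha, fun _ => hb⟩

theorem Bdd_notE (ha : a.Bdd W N ρ) : (notE a).Bdd W N ρ := Bdd_ite ha trivial trivial
theorem Bdd_oneIf (ha : a.Bdd W N ρ) : (oneIf a).Bdd W N ρ := Bdd_ite ha trivial trivial
theorem Bdd_andE (ha : a.Bdd W N ρ) (hb : b.Bdd W N ρ) : (andE a b).Bdd W N ρ :=
  Bdd_ite ha hb trivial
theorem Bdd_orE (ha : a.Bdd W N ρ) (hb : b.Bdd W N ρ) : (orE a b).Bdd W N ρ :=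
  Bdd_ite ha trivial hb
theorem Bdd_impE (ha : a.Bdd W N ρ) (hb : b.Bdd W N ρ) : (impE a b).Bdd W N ρ :=
  Bdd_ite ha hb trivial
theorem Bdd_leE (ha : a.Bdd W N ρ) (hb : b.Bdd W N ρ) : (leE a b).Bdd W N ρ :=
  Bdd_notE ⟨ha, hb⟩
theorem Bdd_eqE (ha : a.Bdd W N ρ) (hb : b.Bdd W N ρ) : (eqE a b).Bdd W N ρ :=
  Bdd_andE (Bdd_leE ha hb) (Bdd_leE hb ha)

variable (W N ρ a b c n)

theorem push_skip (i x : ℕ) :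
    (fun j => push i (push x ρ) (push 0 (fun i => i + 2) j)) = push i ρ := by
  funext j
  cases j <;> rfl

@[simp] theorem eval_sumE : (sumE n b).eval W ρ =
    ∑ i ∈ Finset.range (n.eval W ρ), b.eval W (push i ρ) := by
  simp only [sumE, eval, push_skip, push_one, push_zero]
  induction n.eval W ρ with
  | zero => rfl
  | succ m ih => rw [iter_succ, ih, Finset.sum_range_succ]

@[simp] theorem eval_maxE : (maxE n b).eval W ρ =
    (Finset.range (n.eval W ρ)).sup fun i => b.eval W (push i ρ) := by
  simp only [maxE, eval, push_skip, push_one, push_zero]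
  induction n.eval W ρ with
  | zero => rfl
  | succ m ih =>
    rw [iter_succ, ih, Finset.range_add_one, Finset.sup_insert, sup_comm, Nat.max_def]
    split <;> omega

variable {W N ρ b n} in
theorem Bdd_sumE (hn : n.Bdd W N ρ) (hN : n.eval W ρ ≤ N)
    (hb : ∀ i < n.eval W ρ, b.Bdd W N (push i ρ)) : (sumE n b).Bdd W N ρ := by
  refine ⟨hn, trivial, hN, fun i hi => ⟨trivial, ?_⟩⟩
  simpa only [Bdd, push_skip] using hb i hi

variable {W N ρ b n} in
theorem Bdd_maxE (hn : n.Bdd W N ρ) (hN : n.eval W ρ ≤ N)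
    (hb : ∀ i < n.eval W ρ, b.Bdd W N (push i ρ)) : (maxE n b).Bdd W N ρ := by
  refine ⟨hn, trivial, hN, fun i hi => ⟨trivial, ?_, trivial⟩⟩
  simpa only [Bdd, push_skip] using hb i hi

@[simp] theorem Holds_notE : (notE a).Holds W ρ ↔ ¬ a.Holds W ρ := by
  simp only [notE, Holds, eval]
  split <;> simp_all

@[simp] theorem Holds_andE : (andE a b).Holds W ρ ↔ a.Holds W ρ ∧ b.Holds W ρ := by
  simp only [andE, Holds, eval]
  split <;> simp_all

@[simp] theorem Holds_orE : (orE a b).Holds W ρ ↔ a.Holds W ρ ∨ b.Holds W ρ := by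
  simp only [orE, Holds, eval]
  split <;> simp_all

@[simp] theorem Holds_impE : (impE a b).Holds W ρ ↔ (a.Holds W ρ → b.Holds W ρ) := by
  simp only [impE, Holds, eval]
  split <;> simp_all

@[simp] theorem Holds_leE : (leE a b).Holds W ρ ↔ a.eval W ρ ≤ b.eval W ρ := by
  simp [leE, Holds, notE, eval, Nat.sub_eq_zero_iff_le]

@[simp] theorem Holds_eqE : (eqE a b).Holds W ρ ↔ a.eval W ρ = b.eval W ρ := by
  simp [eqE, le_antisymm_iff]

@[simp] theorem Holds_exE : (exE n b).Holds W ρ ↔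
    ∃ i < n.eval W ρ, b.Holds W (push i ρ) := by
  simp [exE, Holds, Finset.sum_eq_zero_iff]

@[simp] theorem Holds_allE : (allE n b).Holds W ρ ↔
    ∀ i < n.eval W ρ, b.Holds W (push i ρ) := by
  simp [allE]

open Classical in
@[simp] theorem eval_oneIf : (oneIf a).eval W ρ = if a.Holds W ρ then 1 else 0 := by
  simp [oneIf]

@[simp] theorem eval_mulE : (mulE a b).eval W ρ = a.eval W ρ * b.eval W ρ := by
  simp [mulE]

@[simp] theorem eval_powE : (powE a b).eval W ρ = a.eval W ρ ^ b.eval W ρ := by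
  rw [powE, eval]
  simp only [eval_const, eval_mulE, eval_sh, eval_var, push_one, push_zero]
  induction b.eval W ρ with
  | zero => rfl
  | succ m ih => rw [iter_succ, ih, pow_succ']

@[simp] theorem eval_divE : (divE a b).eval W ρ = a.eval W ρ / b.eval W ρ := by
  simp only [divE, eval_ite, Holds, eval_sumE, eval_oneIf, eval_const]
  by_cases hb : b.eval W ρ = 0
  · simp [hb]
  · have hb' := Nat.pos_of_ne_zero hb
    rw [if_pos hb]
    have h : ∀ q, ((leE (mulE (add (var 0) (const 1)) (sh b)) (sh a)).eval W (push q ρ) ≠ 0) ↔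
        q < a.eval W ρ / b.eval W ρ := fun q => by
      rw [← Holds, Holds_leE]
      simp only [eval_mulE, eval_add, eval_var, push_zero, eval_const, eval_sh]
      rw [← Nat.le_div_iff_mul_le hb', Nat.succ_le_iff]
    simp only [h, Finset.sum_boole]
    have : (Finset.range (a.eval W ρ)).filter (· < a.eval W ρ / b.eval W ρ) =
        Finset.range (a.eval W ρ / b.eval W ρ) := by
      ext q
      simp only [Finset.mem_filter, Finset.mem_range, and_iff_right_iff_imp]
      exact fun h => h.trans_le (Nat.div_le_self _ _)
    simp [this]

@[simp] theorem eval_modE : (modE a b).eval W ρ = a.eval W ρ % b.eval W ρ := by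
  simp only [modE, eval_sub, eval_mulE, eval_divE]
  have := Nat.div_add_mod (a.eval W ρ) (b.eval W ρ)
  rw [mul_comm] at this
  omega

variable {W N ρ a b n}

theorem Bdd_exE (hn : n.Bdd W N ρ) (hN : n.eval W ρ ≤ N)
    (hb : ∀ i < n.eval W ρ, b.Bdd W N (push i ρ)) : (exE n b).Bdd W N ρ :=
  Bdd_sumE hn hN hb

theorem Bdd_allE (hn : n.Bdd W N ρ) (hN : n.eval W ρ ≤ N)
    (hb : ∀ i < n.eval W ρ, b.Bdd W N (push i ρ)) : (allE n b).Bdd W N ρ :=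
  Bdd_notE (Bdd_sumE hn hN fun i hi => Bdd_notE (hb i hi))

theorem Bdd_mulE (ha : a.Bdd W N ρ) (hb : b.Bdd W N ρ) (hN : a.eval W ρ ≤ N) :
    (mulE a b).Bdd W N ρ :=
  Bdd_sumE ha hN fun _ _ => hb

theorem Bdd_powE (ha : a.Bdd W N ρ) (hb : b.Bdd W N ρ) (haN : a.eval W ρ ≤ N)
    (hbN : b.eval W ρ ≤ N) : (powE a b).Bdd W N ρ :=
  ⟨hb, trivial, hbN, fun _ _ => Bdd_mulE ha trivial haN⟩

theorem Bdd_divE (ha : a.Bdd W N ρ) (hb : b.Bdd W N ρ) (hN : a.eval W ρ ≤ N) :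
    (divE a b).Bdd W N ρ :=
  Bdd_ite hb (Bdd_sumE ha hN fun i hi => Bdd_oneIf (Bdd_leE (Bdd_mulE ⟨trivial, trivial⟩ hb
    (show i + 1 ≤ N by omega)) ha)) trivial

theorem Bdd_modE (ha : a.Bdd W N ρ) (hb : b.Bdd W N ρ) (hN : a.eval W ρ ≤ N) :
    (modE a b).Bdd W N ρ :=
  ⟨ha, Bdd_mulE (Bdd_divE ha hb hN) hb (by
    rw [eval_divE]
    exact (Nat.div_le_self _ _).trans hN)⟩

end

end Expr

/-- A problem is fixed-parameter tractable if an expression decides it with loops of length at most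
`F κ * |I|`. -/
theorem ParamProblem.fpt_of_expr (P : ParamProblem) (e : Expr) (F : ℕ → ℕ) (hF : Computable F)
    (h : ∀ I, 1 ≤ F (P.param I) * bitLength (P.encode I) ∧
      e.Bdd (fun j => (P.encode I).getD j 0) (F (P.param I) * bitLength (P.encode I)) (fun _ => 0) ∧
      (e.Holds (fun j => (P.encode I).getD j 0) (fun _ => 0) ↔ P.yes I)) : P.FPT := by
  -- All variables are kept in register `0`, which stays `0` because the result register is `1`. The
  -- last addition moves the result to register `0` and accounts for the `+ 1` in the factor.
  refine ⟨.seq (e.compile (fun _ => 0) 1) (.add 0 0 1),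
    fun κ => (e.factor + 1) * F κ ^ e.depth, e.depth, ?_, fun I => ?_⟩
  · have hpow : Computable₂ fun a b : ℕ => a ^ b :=
      (Primrec₂.unpaired'.1 Nat.Primrec.pow).to_comp
    exact Primrec.nat_mul.to_comp.comp (Computable.const _) (hpow.comp hF (Computable.const _))
  · obtain ⟨hN, hb, hy⟩ := h I
    obtain ⟨t, s, hx, ht, hm, hj, hd⟩ := e.compile_correct hN (fun _ => 0) 1 (fun _ => 0)
      (inputState (P.encode I)) (fun _ => zero_lt_one) (fun _ => rfl) rfl hb
    refine ⟨_, _, .seq hx (.add _ _ _ _), ?_, ?_⟩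
    · have : 1 ≤ (F (P.param I) * bitLength (P.encode I)) ^ e.depth := Nat.one_le_pow _ _ hN
      rw [mul_assoc, ← mul_pow, add_mul]
      omega
    · rw [State.setReg_reg, if_pos rfl, hd, hj 0 zero_lt_one, ← hy]
      simp [inputState, Expr.Holds]

/-! ### Reading an instance off its input word -/

namespace Instance

/-- The encoding of an instance as a function. -/
noncomputable def word (I : Instance) (j : ℕ) : ℕ := I.encode.getD j 0

/-- The color of a vertex in `{1, …, l}`, or `0` if it is not precolored. -/
def col (I : Instance) (v : Fin I.n) : ℕ := (I.p v).elim 0 fun j => (j : ℕ) + 1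

variable (I : Instance)

@[simp] theorem word_zero : I.word 0 = I.n := rfl
@[simp] theorem word_one : I.word 1 = I.l := rfl
@[simp] theorem word_two : I.word 2 = I.k := rfl

theorem word_col (v : Fin I.n) : I.word (3 + v) = I.col v := by
  simp only [word, encode]
  rw [List.getD_append _ _ _ _ (by simp; omega), List.getD_append_right _ _ _ _ (by simp)]
  simp [List.getD_eq_getElem?_getD, col]

open Classical in
theorem word_adj (u v : Fin I.n) :
    I.word (3 + I.n + (I.n * u + v)) = if I.G.Adj u v then 1 else 0 := by
  have hlt : I.n * u + v < I.n * I.n := by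
    have h1 : I.n * (u + 1) ≤ I.n * I.n := Nat.mul_le_mul_left _ u.2
    have h2 := v.2
    rw [mul_add] at h1
    omega
  -- Row-major order: row and column are quotient and remainder of the cell number modulo `n`.
  have hflat : (List.ofFn fun u : Fin I.n => List.ofFn fun v : Fin I.n =>
      if I.G.Adj u v then 1 else 0).flatten = List.ofFn fun k : Fin (I.n * I.n) =>
        if I.G.Adj k.divNat k.modNat then 1 else 0 := by
    rw [List.ofFn_mul]
    congr 2
    funext i
    congr 1
    funext j
    have h1 : (⟨i * I.n + j, by
        have h1 : (i + 1) * I.n ≤ I.n * I.n := Nat.mul_le_mul_right _ i.2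
        have h2 := j.2
        rw [add_mul] at h1
        omega⟩ : Fin (I.n * I.n)).divNat = i := by
      ext
      simp [Fin.divNat, Nat.div_eq_of_lt, Nat.add_div_of_dvd_right, i.pos]
    have h2 : (⟨i * I.n + j, by
        have h1 : (i + 1) * I.n ≤ I.n * I.n := Nat.mul_le_mul_right _ i.2
        have h2 := j.2
        rw [add_mul] at h1
        omega⟩ : Fin (I.n * I.n)).modNat = j := by
      ext
      simp [Fin.modNat, Nat.mod_eq_of_lt]
    rw [h1, h2]
  have h1 : (⟨I.n * u + v, hlt⟩ : Fin (I.n * I.n)).divNat = u := by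
    ext
    simp [Fin.divNat, Nat.mul_add_div, u.pos, Nat.div_eq_of_lt]
  have h2 : (⟨I.n * u + v, hlt⟩ : Fin (I.n * I.n)).modNat = v := by
    ext
    simp [Fin.modNat, Nat.mod_eq_of_lt]
  simp only [word, encode, hflat]
  rw [List.getD_append_right _ _ _ _ (by simp; omega)]
  simp only [List.length_append, List.length_cons, List.length_nil, List.length_ofFn]
  rw [show 3 + I.n + (I.n * u + v) - (0 + 1 + 1 + 1 + I.n) = I.n * u + v by omega,
    List.getD_eq_getElem _ _ (by simpa using hlt), List.getElem_ofFn, h1, h2]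

/-- Each number of the word contributes at least its separator to the bit length. -/
theorem n_lt_bitLength : I.n + 2 < bitLength I.encode := by
  have h : ∀ w : List ℕ, w.length ≤ bitLength w := fun w => by
    induction w with
    | nil => simp
    | cons x w ih =>
      simp only [bitLength, List.map_cons, List.sum_cons, List.length_cons] at ih ⊢
      omega
  refine lt_of_lt_of_le ?_ (h _)
  simp only [encode, List.length_append, List.length_cons, List.length_nil, List.length_ofFn]
  omega

end Instance

/-! ### Choosing colors for the classes of a partition of a vertex cover -/

section Choice

/-- A coloring of `m` points, up to renaming the colors, uses only the colors below `m`. -/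
theorem exists_labels {V C : Type} (X : Finset V) (c : V → C) :
    ∃ s : V → ℕ, (∀ u ∈ X, s u < X.card) ∧ ∀ u ∈ X, ∀ v ∈ X, s u = s v ↔ c u = c v := by
  classical
  refine ⟨fun u => if h : c u ∈ X.image c then (X.image c).equivFin ⟨c u, h⟩ else 0,
    fun u hu => ?_, fun u hu v hv => ?_⟩
  · have h : c u ∈ X.image c := Finset.mem_image_of_mem c hu
    simp only [h, dif_pos]
    exact (Fin.is_lt _).trans_le Finset.card_image_le
  · have h : c u ∈ X.image c := Finset.mem_image_of_mem c hu
    have h' : c v ∈ X.image c := Finset.mem_image_of_mem c hv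
    simp only [h, h', dif_pos]
    rw [Fin.val_inj, (X.image c).equivFin.apply_eq_iff_eq, Subtype.mk.injEq]

open Classical in
/-- The best weight of an admissible color, plus one; `0` if no color is admissible. The candidates
are the colors in the precoloring `q` (where `0` means not precolored) and color `1`. -/
noncomputable def best {V : Type} [Fintype V] (q : V → ℕ) (K : ℕ → Prop) (wt : ℕ → ℕ) : ℕ :=
  Finset.univ.sup fun w => if K (max (q w) 1) then wt (max (q w) 1) + 1 else 0

variable {V : Type} [Fintype V] {q : V → ℕ} {K : ℕ → Prop} {wt : ℕ → ℕ}

/-- If `j` occurs in the precoloring, it is a candidate itself. Otherwise its weight is `0` and, by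
`hK'`, every color is admissible, so the candidate of an arbitrary vertex does at least as well.
This is why `l` colors need not be tried. -/
theorem le_best [Nonempty V] {j : ℕ} (hj : 1 ≤ j) (hK : K j)
    (hK' : (∀ v, q v ≠ j) → ∀ i, K i) (hwt : (∀ v, q v ≠ j) → wt j = 0) :
    wt j + 1 ≤ best q K wt := by
  by_cases h : ∃ w, q w = j
  · obtain ⟨w, rfl⟩ := h
    refine le_trans ?_ (Finset.le_sup (Finset.mem_univ w))
    rw [max_eq_left hj, if_pos hK]
  · push Not at h
    obtain ⟨w⟩ := ‹Nonempty V›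
    refine le_trans ?_ (Finset.le_sup (Finset.mem_univ w))
    rw [if_pos (hK' h _), hwt h]
    omega

theorem exists_eq_best {l : ℕ} (hl : 1 ≤ l) (hq : ∀ v, q v ≤ l) (h : best q K wt ≠ 0) :
    ∃ j, 1 ≤ j ∧ j ≤ l ∧ K j ∧ best q K wt = wt j + 1 := by
  classical
  have hne : (Finset.univ : Finset V).Nonempty := by
    rw [Finset.nonempty_iff_ne_empty]
    intro h0
    simp [best, h0] at h
  obtain ⟨w, -, hw⟩ := Finset.exists_mem_eq_sup Finset.univ hne
    fun w => if K (max (q w) 1) then wt (max (q w) 1) + 1 else 0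
  have hw' : best q K wt = if K (max (q w) 1) then wt (max (q w) 1) + 1 else 0 := by
    rw [← hw, best]
  by_cases hK : K (max (q w) 1)
  · exact ⟨_, le_max_right _ _, max_le (hq w) hl, hK, by rw [hw', if_pos hK]⟩
  · rw [if_neg hK] at hw'
    exact absurd hw' h

end Choice

/-! ### Happy edges -/

section Edges

variable {V : Type} [Fintype V] (G : SimpleGraph V) (q : V → ℕ) (X : V → Prop) (s : V → ℕ)

/-- Color `j` is admissible for the class `a` of the vertex cover. -/
def EdgeOk (a j : ℕ) : Prop := ∀ u, X u → s u = a → q u = 0 ∨ q u = j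

open Classical in
/-- The number of edges from vertices of the class `a` to vertices with color `j` outside the vertex
cover. -/
noncomputable def edgeWt (a j : ℕ) : ℕ :=
  ∑ v, ∑ u, if ¬ X v ∧ q v = j ∧ X u ∧ G.Adj v u ∧ s u = a then 1 else 0

open Classical in
/-- Twice the number of happy edges that can be had with the partition of the vertex cover `X` into
the `m` classes of the labelling `s`. -/
noncomputable def edgeScore (m : ℕ) : ℕ :=
  (∑ v, ∑ u, if X v ∧ X u ∧ G.Adj v u ∧ s v = s u then 1 else 0) +
  2 * ((∑ v, if ¬ X v ∧ q v = 0 then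
      (Finset.range m).sup fun a => ∑ u, if X u ∧ G.Adj v u ∧ s u = a then 1 else 0 else 0) +
    ∑ a ∈ Finset.range m, (best q (EdgeOk q X s a) (edgeWt G q X s a) - 1))

open Classical in
/-- The number of ordered pairs of adjacent vertices of the same color. -/
noncomputable def happyPairs (c : V → ℕ) : ℕ :=
  ∑ v, ∑ u, if G.Adj v u ∧ c v = c u then 1 else 0

variable {G q X s}

-- No edge has both ends outside the cover. Pairs with exactly one end in the cover occur in two
-- orders, whence the factor `2`; they are then split by whether the outer end is precolored.
open Classical in
theorem happyPairs_eq (hX : ∀ u v, G.Adj u v → X u ∨ X v) (c : V → ℕ) : happyPairs G c =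
    (∑ v, ∑ u, if X v ∧ X u ∧ G.Adj v u ∧ c v = c u then 1 else 0) +
    2 * ((∑ v, if ¬ X v ∧ q v = 0 then
        ∑ u, if X u ∧ G.Adj v u ∧ c v = c u then 1 else 0 else 0) +
      ∑ v, ∑ u, if ¬ X v ∧ q v ≠ 0 ∧ X u ∧ G.Adj v u ∧ c v = c u then 1 else 0) := by
  have h1 : happyPairs G c =
      (∑ v, ∑ u, if X v ∧ X u ∧ G.Adj v u ∧ c v = c u then 1 else 0) +
      ((∑ v, ∑ u, if ¬ X v ∧ X u ∧ G.Adj v u ∧ c v = c u then 1 else 0) +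
      ∑ v, ∑ u, if X v ∧ ¬ X u ∧ G.Adj v u ∧ c v = c u then 1 else 0) := by
    simp only [happyPairs, ← Finset.sum_add_distrib]
    refine Finset.sum_congr rfl fun v _ => Finset.sum_congr rfl fun u _ => ?_
    have := hX v u
    by_cases h1 : X v <;> by_cases h2 : X u <;> simp_all
  have h2 : (∑ v, ∑ u, if X v ∧ ¬ X u ∧ G.Adj v u ∧ c v = c u then 1 else 0) =
      ∑ v, ∑ u, if ¬ X v ∧ X u ∧ G.Adj v u ∧ c v = c u then 1 else 0 := by
    rw [Finset.sum_comm]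
    refine Finset.sum_congr rfl fun v _ => Finset.sum_congr rfl fun u _ => ?_
    exact if_congr (by rw [G.adj_comm u v, eq_comm (a := c u)]; tauto) rfl rfl
  have h3 : (∑ v, ∑ u, if ¬ X v ∧ X u ∧ G.Adj v u ∧ c v = c u then 1 else 0) =
      (∑ v, if ¬ X v ∧ q v = 0 then
        ∑ u, if X u ∧ G.Adj v u ∧ c v = c u then 1 else 0 else 0) +
      ∑ v, ∑ u, if ¬ X v ∧ q v ≠ 0 ∧ X u ∧ G.Adj v u ∧ c v = c u then 1 else 0 := by
    rw [← Finset.sum_add_distrib]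
    refine Finset.sum_congr rfl fun v _ => ?_
    by_cases h1 : X v <;> by_cases h2 : q v = 0 <;> simp [h1, h2]
  rw [h1, h2, h3]
  ring

-- Each pair is charged to the class of its end in the cover; as that label is below `m`, it is
-- counted exactly once.
open Classical in
theorem sum_edgeWt_eq {m : ℕ} (hs : ∀ u, X u → s u < m) (c : V → ℕ) :
    (∑ v, ∑ u, if ¬ X v ∧ q v ≠ 0 ∧ X u ∧ G.Adj v u ∧ c v = c u then 1 else 0) =
    ∑ a ∈ Finset.range m, ∑ v, ∑ u,
      if ¬ X v ∧ q v ≠ 0 ∧ X u ∧ G.Adj v u ∧ c v = c u ∧ s u = a then 1 else 0 := by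
  conv_rhs => rw [Finset.sum_comm]
  refine Finset.sum_congr rfl fun v _ => ?_
  conv_rhs => rw [Finset.sum_comm]
  refine Finset.sum_congr rfl fun u _ => ?_
  by_cases h : ¬ X v ∧ q v ≠ 0 ∧ X u ∧ G.Adj v u ∧ c v = c u
  · rw [if_pos h, Finset.sum_eq_single_of_mem (s u) (Finset.mem_range.2 (hs u h.2.2.1))]
    · rw [if_pos (by tauto)]
    · intro a _ ha
      rw [if_neg]
      rintro ⟨-, -, -, -, -, h⟩
      exact ha h.symm
  · rw [if_neg h, Finset.sum_eq_zero]
    intro a _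
    rw [if_neg (by tauto)]

/-- For the partition induced by `c`, the color that `c` gives to a class is admissible and competes
in `best`. An outer vertex that is not precolored has its happy edges into a single class, which
competes in the maximum over the classes. -/
theorem edgeScore_ge (hX : ∀ u v, G.Adj u v → X u ∨ X v) {m : ℕ} (hs : ∀ u, X u → s u < m)
    [Nonempty V] {c : V → ℕ} (hc : ∀ v, 1 ≤ c v) (hcq : ∀ v, q v ≠ 0 → c v = q v)
    (hsc : ∀ u v, X u → X v → (s u = s v ↔ c u = c v)) :
    (∀ a < m, best q (EdgeOk q X s a) (edgeWt G q X s a) ≠ 0) ∧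
      happyPairs G c ≤ edgeScore G q X s m := by
  classical
  have hb : ∀ u, X u → edgeWt G q X s (s u) (c u) + 1 ≤
      best q (EdgeOk q X s (s u)) (edgeWt G q X s (s u)) := by
    intro u hu
    have hcol : ∀ w, X w → s w = s u → q w = 0 ∨ q w = c u := fun w hw h => by
      by_cases h0 : q w = 0
      · exact .inl h0
      · exact .inr (by rw [← hcq w h0, (hsc w u hw hu).1 h])
    refine le_best (hc u) hcol ?_ ?_
    · intro h i w hw hwu
      exact .inl ((hcol w hw hwu).resolve_right (h w))
    · intro h
      simp [edgeWt, h]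
  -- There may be fewer classes than labels. An unused label constrains nothing, and so it must pass
  -- the test `best ≠ 0`.
  have hb0 : ∀ a, (∀ u, X u → s u ≠ a) →
      1 ≤ best q (EdgeOk q X s a) (edgeWt G q X s a) := by
    intro a h
    have hK : ∀ i, EdgeOk q X s a i := fun i u hu hua => absurd hua (h u hu)
    exact le_trans (Nat.le_add_left _ _) (le_best le_rfl (hK 1) (fun _ => hK)
      (fun _ => by
        refine Finset.sum_eq_zero fun v _ => Finset.sum_eq_zero fun u _ => if_neg ?_
        rintro ⟨-, -, hu, -, hua⟩
        exact h u hu hua))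
  refine ⟨fun a _ => ?_, ?_⟩
  · by_cases h : ∃ u, X u ∧ s u = a
    · obtain ⟨u, hu, rfl⟩ := h
      have := hb u hu
      omega
    · push Not at h
      have := hb0 a h
      omega
  · rw [happyPairs_eq (q := q) hX, edgeScore, sum_edgeWt_eq hs]
    refine Nat.add_le_add ?_ (Nat.mul_le_mul_left 2 (Nat.add_le_add ?_ ?_))
    · refine Finset.sum_le_sum fun v _ => Finset.sum_le_sum fun u _ => ?_
      have := hsc v u
      split_ifs <;> grind
    · refine Finset.sum_le_sum fun v _ => ?_
      split_ifs
      · by_cases h : ∃ u, X u ∧ G.Adj v u ∧ c v = c u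
        · obtain ⟨u, hu, hvu, hcu⟩ := h
          refine le_trans ?_ (Finset.le_sup (Finset.mem_range.2 (hs u hu)))
          refine Finset.sum_le_sum fun w _ => ?_
          have := hsc w u
          split_ifs <;> grind
        · rw [Finset.sum_eq_zero]
          · exact Nat.zero_le _
          · intro u _
            rw [if_neg fun hu => h ⟨u, hu⟩]
      · exact le_rfl
    -- With a representative `u` of the class, the precolored outer ends of its happy edges all have
    -- precolor `c u`.
    · refine Finset.sum_le_sum fun a _ => ?_
      by_cases h : ∃ u, X u ∧ s u = a
      · obtain ⟨u, hu, rfl⟩ := h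
        have h1 := hb u hu
        refine le_trans ?_ (Nat.le_sub_of_add_le h1)
        refine Finset.sum_le_sum fun v _ => Finset.sum_le_sum fun w _ => ?_
        have h2 := hsc w u
        have h3 := hcq v
        split_ifs <;> grind
      · push Not at h
        rw [Finset.sum_eq_zero]
        · exact Nat.zero_le _
        · intro v _
          rw [Finset.sum_eq_zero]
          intro u _
          rw [if_neg]
          rintro ⟨-, -, hu, -, -, hua⟩
          exact h u hu hua

/-- Each class gets its best color and each remaining outer vertex the color of the class where it
has most neighbors. The class colors `γ` need not be distinct: coincidences can only create further
happy edges. -/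
theorem exists_edgeScore_le (hX : ∀ u v, G.Adj u v → X u ∨ X v) {m : ℕ}
    (hs : ∀ u, X u → s u < m) {l : ℕ} (hl : 1 ≤ l) (hq : ∀ v, q v ≤ l)
    (hb : ∀ a < m, best q (EdgeOk q X s a) (edgeWt G q X s a) ≠ 0) :
    ∃ c : V → ℕ, (∀ v, 1 ≤ c v ∧ c v ≤ l) ∧ (∀ v, q v ≠ 0 → c v = q v) ∧
      edgeScore G q X s m ≤ happyPairs G c := by
  classical
  have hγ : ∀ a, ∃ j, 1 ≤ j ∧ j ≤ l ∧ (a < m → EdgeOk q X s a j ∧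
      best q (EdgeOk q X s a) (edgeWt G q X s a) = edgeWt G q X s a j + 1) := fun a => by
    by_cases ha : a < m
    · obtain ⟨j, h1, h2, h3⟩ := exists_eq_best hl hq (hb a ha)
      exact ⟨j, h1, h2, fun _ => h3⟩
    -- The default color keeps `γ (b v)` legal even for `m = 0`, where `b v` is no label below `m`.
    · exact ⟨1, le_rfl, hl, fun h => absurd h ha⟩
  choose γ hγ1 hγl hγ using hγ
  have hlab : ∀ v, ∃ a, ((Finset.range m).sup fun a =>
      ∑ u, if X u ∧ G.Adj v u ∧ s u = a then 1 else 0) ≤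
      ∑ u, if X u ∧ G.Adj v u ∧ s u = a then 1 else 0 := fun v => by
    rcases (Finset.range m).eq_empty_or_nonempty with h | h
    · exact ⟨0, by simp [h]⟩
    · obtain ⟨a, -, ha⟩ := Finset.exists_mem_eq_sup _ h fun a =>
        ∑ u, if X u ∧ G.Adj v u ∧ s u = a then 1 else 0
      exact ⟨a, ha.le⟩
  choose b hb' using hlab
  let c : V → ℕ := fun v => if q v ≠ 0 then q v else if X v then γ (s v) else γ (b v)
  -- Admissibility makes a precolored vertex of the cover agree with the color of its class.
  have hcX : ∀ v, X v → c v = γ (s v) := fun v hv => by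
    rcases (hγ _ (hs v hv)).1 v hv rfl with h | h
    · simp [c, h, hv]
    · by_cases h0 : q v = 0
      · simp [c, h0, hv]
      · exact (if_pos h0).trans h
  refine ⟨c, fun v => ?_, fun v hv => if_pos hv, ?_⟩
  · simp only [c]
    have := hq v
    split_ifs
    · omega
    · exact ⟨hγ1 _, hγl _⟩
    · exact ⟨hγ1 _, hγl _⟩
  · rw [happyPairs_eq (q := q) hX, edgeScore, sum_edgeWt_eq hs]
    refine Nat.add_le_add ?_ (Nat.mul_le_mul_left 2 (Nat.add_le_add ?_ ?_))
    · refine Finset.sum_le_sum fun v _ => Finset.sum_le_sum fun u _ => ?_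
      have := hcX v
      have := hcX u
      split_ifs <;> grind
    · refine Finset.sum_le_sum fun v _ => ?_
      split_ifs with h
      · refine (hb' v).trans (Finset.sum_le_sum fun u _ => ?_)
        have h1 := hcX u
        have h2 : c v = γ (b v) := by simp [c, h]
        split_ifs <;> grind
      · exact le_rfl
    · refine Finset.sum_le_sum fun a ha => ?_
      obtain ⟨h1, h2⟩ := hγ a (Finset.mem_range.1 ha)
      rw [h2, Nat.add_sub_cancel, edgeWt]
      refine Finset.sum_le_sum fun v _ => Finset.sum_le_sum fun u _ => ?_
      have h3 := hcX u
      have h4 := hγ1 a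
      have h5 : q v ≠ 0 → c v = q v := fun hv => if_pos hv
      split_ifs <;> grind

/-- Handshake lemma for the subgraph of monochromatic edges. -/
theorem two_mul_ncard_happyEdges {C : Type} (c : V → C) (c' : V → ℕ)
    (h : ∀ u v, c u = c v ↔ c' u = c' v) :
    2 * (happyEdges G c).ncard = happyPairs G c' := by
  classical
  let H : SimpleGraph V :=
    { Adj := fun u v => G.Adj u v ∧ c' u = c' v
      symm := ⟨fun u v h => ⟨h.1.symm, h.2.symm⟩⟩
      loopless := ⟨fun u h => G.loopless.1 u h.1⟩ }
  have h1 : happyEdges G c = (H.edgeFinset : Set (Sym2 V)) := by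
    ext e
    induction e with
    | _ u v =>
      simp only [happyEdges, Set.mem_ofPred_eq, SimpleGraph.mem_edgeSet, Sym2.mem_iff,
        SimpleGraph.coe_edgeFinset, h, H]
      constructor
      · rintro ⟨h1, h2⟩
        exact ⟨h1, h2 u (.inl rfl) v (.inr rfl)⟩
      · rintro ⟨h1, h2⟩
        refine ⟨h1, ?_⟩
        rintro x (rfl | rfl) y (rfl | rfl) <;> simp [h2]
  rw [h1, Set.ncard_coe_finset, ← SimpleGraph.sum_degrees_eq_twice_card_edges, happyPairs]
  refine Finset.sum_congr rfl fun v _ => ?_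
  rw [Finset.sum_boole, ← SimpleGraph.card_neighborFinset_eq_degree]
  simp only [Nat.cast_id]
  congr 1
  ext u
  simp [H]

end Edges

/-! ### Happy vertices -/

section Vertices

variable {V : Type} [Fintype V] (G : SimpleGraph V) (q : V → ℕ) (X H : V → Prop) (s : V → ℕ)

/-- The vertices in `H` can be happy if the vertex cover `X` is colored according to the
labelling `s` and the vertices outside `X` are colored suitably. -/
def VertexOk : Prop :=
  (∀ v u, H v → X u → G.Adj v u → s v = s u) ∧
  ∀ v u w, ¬ X v ∧ q v = 0 → H u → H w → G.Adj v u → G.Adj v w → s u = s w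

/-- Color `j` is admissible for the class `a` of the vertex cover, where the vertices in `H` have to
be happy. -/
def ClassOk (a j : ℕ) : Prop :=
  ∀ u, X u → s u = a → (q u = 0 ∨ q u = j) ∧ (H u → ∀ v, G.Adj u v → q v = 0 ∨ q v = j)

open Classical in
/-- The number of vertices of color `j` outside the vertex cover that have neighbors, all of them in
the class `a`. -/
noncomputable def vertexWt (a j : ℕ) : ℕ :=
  ∑ v, if ¬ X v ∧ q v = j ∧ (∃ u, G.Adj v u) ∧ ∀ u, G.Adj v u → s u = a then 1 else 0

open Classical in
/-- The number of happy vertices that can be had with the partition of the vertex cover `X` into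
the `m` classes of the labelling `s`, with those in `H` happy. -/
noncomputable def vertexScore (m : ℕ) : ℕ :=
  (∑ v, if H v then 1 else 0) +
  (∑ v, if ¬ X v ∧ (q v = 0 ∨ ∀ u, ¬ G.Adj v u) ∧ ∀ u w, G.Adj v u → G.Adj v w → s u = s w
    then 1 else 0) +
  ∑ a ∈ Finset.range m, (best q (ClassOk G q X H s a) (vertexWt G q X s a) - 1)

variable {G q X H s}

/-- Here `H` is the set of vertices of the cover that are happy under `c`, and the labelling is
induced by `c`. The color of each class under `c` is then admissible and competes in `best`. -/
theorem vertexScore_ge (hX : ∀ u v, G.Adj u v → X u ∨ X v) {m : ℕ} (hs : ∀ u, X u → s u < m)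
    [Nonempty V] {c : V → ℕ} (hc : ∀ v, 1 ≤ c v) (hcq : ∀ v, q v ≠ 0 → c v = q v)
    (hsc : ∀ u v, X u → X v → (s u = s v ↔ c u = c v))
    (hH : ∀ v, H v ↔ X v ∧ ∀ u, G.Adj v u → c u = c v) :
    VertexOk G q X H s ∧
      (∀ a < m, best q (ClassOk G q X H s a) (vertexWt G q X s a) ≠ 0) ∧
      (happyVertices G c).ncard ≤ vertexScore G q X H s m := by
  classical
  have hb : ∀ u, X u → vertexWt G q X s (s u) (c u) + 1 ≤
      best q (ClassOk G q X H s (s u)) (vertexWt G q X s (s u)) := by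
    intro u hu
    have hcol : ClassOk G q X H s (s u) (c u) := fun w hw h => by
      have hwu := (hsc w u hw hu).1 h
      refine ⟨?_, fun hHw v hwv => ?_⟩
      · by_cases h0 : q w = 0
        · exact .inl h0
        · exact .inr (by rw [← hcq w h0, hwu])
      · by_cases h0 : q v = 0
        · exact .inl h0
        · exact .inr (by rw [← hcq v h0, ((hH w).1 hHw).2 v hwv, hwu])
    refine le_best (hc u) hcol ?_ ?_
    · intro h i w hw hwu
      exact ⟨.inl ((hcol w hw hwu).1.resolve_right (h w)),
        fun hHw v hwv => .inl (((hcol w hw hwu).2 hHw v hwv).resolve_right (h v))⟩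
    · intro h
      simp [vertexWt, h]
  have hb0 : ∀ a, (∀ u, X u → s u ≠ a) →
      1 ≤ best q (ClassOk G q X H s a) (vertexWt G q X s a) := by
    intro a h
    have hK : ∀ i, ClassOk G q X H s a i := fun i u hu hua => absurd hua (h u hu)
    refine le_trans (Nat.le_add_left _ _) (le_best le_rfl (hK 1) (fun _ => hK) (fun _ => ?_))
    refine Finset.sum_eq_zero fun v _ => if_neg ?_
    rintro ⟨hv, -, ⟨u, hvu⟩, h'⟩
    exact h u ((hX v u hvu).resolve_left hv) (h' u hvu)
  refine ⟨⟨fun v u hv hu hvu => ?_, fun v u w hv hu hw hvu hvw => ?_⟩, fun a _ => ?_, ?_⟩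
  · rw [hH] at hv
    exact (hsc v u hv.1 hu).2 (hv.2 u hvu).symm
  · rw [hH] at hu hw
    refine (hsc u w hu.1 hw.1).2 ?_
    rw [← hu.2 v hvu.symm, ← hw.2 v hvw.symm]
  · by_cases h : ∃ u, X u ∧ s u = a
    · obtain ⟨u, hu, rfl⟩ := h
      have := hb u hu
      omega
    · push Not at h
      have := hb0 a h
      omega
  · have h1 : (happyVertices G c).ncard =
        ∑ v, if ∀ u, G.Adj v u → c u = c v then 1 else 0 := by
      rw [Finset.sum_boole, Nat.cast_id, ← Set.ncard_coe_finset]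
      congr 1
      ext v
      simp [happyVertices]
    -- A happy vertex lies in `H`, or is an outer vertex that is isolated or not precolored, or is
    -- precolored with all its neighbors in one class.
    have h2 : ∀ v, (if ∀ u, G.Adj v u → c u = c v then 1 else 0) ≤
        (if H v then 1 else 0) +
        (if ¬ X v ∧ (q v = 0 ∨ ∀ u, ¬ G.Adj v u) ∧ ∀ u w, G.Adj v u → G.Adj v w → s u = s w
          then 1 else 0) +
        ∑ a ∈ Finset.range m, if ¬ X v ∧ (∀ u, G.Adj v u → c u = c v) ∧ q v ≠ 0 ∧
          (∃ u, G.Adj v u) ∧ ∀ u, G.Adj v u → s u = a then 1 else 0 := by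
      intro v
      by_cases hv : ∀ u, G.Adj v u → c u = c v
      · rw [if_pos hv]
        by_cases hXv : X v
        · rw [if_pos ((hH v).2 ⟨hXv, hv⟩)]
          omega
        · have hXu : ∀ u, G.Adj v u → X u := fun u h => (hX v u h).resolve_left hXv
          have hmono : ∀ u w, G.Adj v u → G.Adj v w → s u = s w := fun u w hu hw =>
            (hsc u w (hXu u hu) (hXu w hw)).2 ((hv u hu).trans (hv w hw).symm)
          by_cases hq : q v = 0 ∨ ∀ u, ¬ G.Adj v u
          · rw [if_pos (c := ¬ X v ∧ _) ⟨hXv, hq, hmono⟩]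
            omega
          · push Not at hq
            obtain ⟨hq, u, hu⟩ := hq
            have := Finset.single_le_sum (f := fun a => if ¬ X v ∧
              (∀ u, G.Adj v u → c u = c v) ∧ q v ≠ 0 ∧ (∃ u, G.Adj v u) ∧
              ∀ u, G.Adj v u → s u = a then 1 else 0) (fun _ _ => Nat.zero_le _)
              (Finset.mem_range.2 (hs u (hXu u hu)))
            rw [if_pos ⟨hXv, hv, hq, ⟨u, hu⟩, fun w hw => hmono w u hw hu⟩] at this
            omega
      · rw [if_neg hv]
        exact Nat.zero_le _
    rw [h1, vertexScore]
    refine (Finset.sum_le_sum fun v _ => h2 v).trans ?_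
    rw [Finset.sum_add_distrib, Finset.sum_add_distrib, Finset.sum_comm (t := Finset.range m)]
    refine Nat.add_le_add_left (Finset.sum_le_sum fun a _ => ?_) _
    by_cases h : ∃ u, X u ∧ s u = a
    · obtain ⟨u, hu, rfl⟩ := h
      refine le_trans ?_ (Nat.le_sub_of_add_le (hb u hu))
      refine Finset.sum_le_sum fun v _ => ?_
      split_ifs with h3 h4
      · exact le_rfl
      · obtain ⟨hv, h5, h6, ⟨w, hw⟩, h7⟩ := h3
        refine absurd ⟨hv, ?_, ⟨w, hw⟩, h7⟩ h4
        rw [← hcq v h6, ← h5 w hw]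
        exact (hsc w u ((hX v w hw).resolve_left hv) hu).1 (h7 w hw)
      · exact Nat.zero_le _
      · exact le_rfl
    · push Not at h
      rw [Finset.sum_eq_zero]
      · exact Nat.zero_le _
      · intro v _
        rw [if_neg]
        rintro ⟨hv, -, -, ⟨u, hvu⟩, h'⟩
        exact h u ((hX v u hvu).resolve_left hv) (h' u hvu)

/-- Classes get their best colors. An outer vertex that is not precolored follows a neighbor in `H`
if there is one, and otherwise any neighbor. `VertexOk` makes this choice consistent, and `ClassOk`
takes care of the precolored neighbors of `H`. -/
theorem exists_vertexScore_le (hX : ∀ u v, G.Adj u v → X u ∨ X v) {m : ℕ}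
    (hs : ∀ u, X u → s u < m) {l : ℕ} (hl : 1 ≤ l) (hq : ∀ v, q v ≤ l)
    (hHX : ∀ v, H v → X v) (hok : VertexOk G q X H s)
    (hb : ∀ a < m, best q (ClassOk G q X H s a) (vertexWt G q X s a) ≠ 0) :
    ∃ c : V → ℕ, (∀ v, 1 ≤ c v ∧ c v ≤ l) ∧ (∀ v, q v ≠ 0 → c v = q v) ∧
      vertexScore G q X H s m ≤ (happyVertices G c).ncard := by
  classical
  have hγ : ∀ a, ∃ j, 1 ≤ j ∧ j ≤ l ∧ (a < m → ClassOk G q X H s a j ∧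
      best q (ClassOk G q X H s a) (vertexWt G q X s a) = vertexWt G q X s a j + 1) := fun a => by
    by_cases ha : a < m
    · obtain ⟨j, h1, h2, h3⟩ := exists_eq_best hl hq (hb a ha)
      exact ⟨j, h1, h2, fun _ => h3⟩
    · exact ⟨1, le_rfl, hl, fun h => absurd h ha⟩
  choose γ hγ1 hγl hγ using hγ
  have hlab : ∀ v, ∃ a, (¬ X v ∧ q v = 0 → (∀ u, H u → G.Adj v u → s u = a) ∧
      ((∀ u w, G.Adj v u → G.Adj v w → s u = s w) → ∀ u, G.Adj v u → s u = a)) := fun v => by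
    by_cases h1 : ∃ u, H u ∧ G.Adj v u
    · obtain ⟨u, hu, hvu⟩ := h1
      exact ⟨s u, fun hv => ⟨fun w hw hvw => hok.2 v w u hv hw hu hvw hvu,
        fun h w hvw => h w u hvw hvu⟩⟩
    · push Not at h1
      by_cases h2 : ∃ u, G.Adj v u
      · obtain ⟨u, hvu⟩ := h2
        exact ⟨s u, fun hv => ⟨fun w hw hvw => absurd hvw (h1 w hw),
          fun h w hvw => h w u hvw hvu⟩⟩
      · push Not at h2
        exact ⟨0, fun _ => ⟨fun w _ hvw => absurd hvw (h2 w), fun _ w hvw => absurd hvw (h2 w)⟩⟩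
  choose b hb' using hlab
  let c : V → ℕ := fun v => if q v ≠ 0 then q v else if X v then γ (s v) else γ (b v)
  have hcq : ∀ v, q v ≠ 0 → c v = q v := fun v hv => if_pos hv
  have hcX : ∀ v, X v → c v = γ (s v) := fun v hv => by
    rcases ((hγ _ (hs v hv)).1 v hv rfl).1 with h | h
    · simp [c, h, hv]
    · by_cases h0 : q v = 0
      · simp [c, h0, hv]
      · exact (if_pos h0).trans h
  have hcb : ∀ v, ¬ X v ∧ q v = 0 → c v = γ (b v) := fun v hv => by simp [c, hv]
  refine ⟨c, fun v => ?_, hcq, ?_⟩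
  · simp only [c]
    have := hq v
    split_ifs
    · omega
    · exact ⟨hγ1 _, hγl _⟩
    · exact ⟨hγ1 _, hγl _⟩
  · have hX' : ∀ v u, ¬ X v → G.Adj v u → X u := fun v u hv h => (hX v u h).resolve_left hv
    have hH : ∀ v, H v → ∀ u, G.Adj v u → c u = c v := fun v hv u hvu => by
      rw [hcX v (hHX v hv)]
      by_cases hu : X u
      · rw [hcX u hu, hok.1 v u hv hu hvu]
      · by_cases h0 : q u = 0
        · rw [hcb u ⟨hu, h0⟩, (hb' u ⟨hu, h0⟩).1 v hv hvu.symm]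
        · rw [hcq u h0]
          exact (((hγ _ (hs v (hHX v hv))).1 v (hHX v hv) rfl).2 hv u hvu).resolve_left h0
    have h1 : (happyVertices G c).ncard =
        ∑ v, if ∀ u, G.Adj v u → c u = c v then 1 else 0 := by
      rw [Finset.sum_boole, Nat.cast_id, ← Set.ncard_coe_finset]
      congr 1
      ext v
      simp [happyVertices]
    -- A vertex with neighbors has them all in at most one class, so summing over the classes counts
    -- no vertex twice.
    have h2 : vertexScore G q X H s m ≤ (∑ v, if H v then 1 else 0) +
        (∑ v, if ¬ X v ∧ (q v = 0 ∨ ∀ u, ¬ G.Adj v u) ∧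
          ∀ u w, G.Adj v u → G.Adj v w → s u = s w then 1 else 0) +
        ∑ v, if ¬ X v ∧ q v ≠ 0 ∧ (∃ u, G.Adj v u) ∧ ∀ u, G.Adj v u → c u = c v
          then 1 else 0 := by
      refine Nat.add_le_add_left ?_ _
      have h3 : ∀ a ∈ Finset.range m,
          best q (ClassOk G q X H s a) (vertexWt G q X s a) - 1 = ∑ v,
            if ¬ X v ∧ q v = γ a ∧ (∃ u, G.Adj v u) ∧ ∀ u, G.Adj v u → s u = a
              then 1 else 0 := fun a ha => by
        rw [(hγ a (Finset.mem_range.1 ha)).2, Nat.add_sub_cancel, vertexWt]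
      rw [Finset.sum_congr rfl h3, Finset.sum_comm]
      refine Finset.sum_le_sum fun v _ => ?_
      by_cases hv : ∃ u, G.Adj v u
      · obtain ⟨u, hu⟩ := hv
        rw [Finset.sum_eq_single (s u)]
        · split_ifs with h4 h5
          · exact le_rfl
          · refine absurd ⟨h4.1, ?_, ⟨u, hu⟩, fun w hw => ?_⟩ h5
            · have := hγ1 (s u)
              omega
            · rw [hcX w (hX' v w h4.1 hw), h4.2.2.2 w hw, ← h4.2.1, hcq v]
              have := hγ1 (s u)
              omega
          · exact Nat.zero_le _
          · exact le_rfl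
        · intro a _ ha
          rw [if_neg]
          rintro ⟨-, -, -, h⟩
          exact ha (h u hu).symm
        · intro h
          rw [if_neg]
          rintro ⟨hv, -⟩
          exact h (Finset.mem_range.2 (hs u (hX' v u hv hu)))
      · rw [Finset.sum_eq_zero]
        · exact Nat.zero_le _
        · intro a _
          rw [if_neg fun h => hv h.2.2.1]
    refine h2.trans ?_
    rw [h1, ← Finset.sum_add_distrib, ← Finset.sum_add_distrib]
    refine Finset.sum_le_sum fun v _ => ?_
    by_cases hXv : X v
    · simp only [hXv, not_true_eq_false, false_and, if_false, add_zero]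
      split_ifs with h3 h4
      · exact le_rfl
      · exact absurd (hH v h3) h4
      · exact Nat.zero_le _
      · exact le_rfl
    · rw [if_neg fun h => hXv (hHX v h), zero_add]
      by_cases h0 : q v = 0
      · rw [if_neg (c := ¬ X v ∧ q v ≠ 0 ∧ _) fun h => h.2.1 h0, add_zero]
        split_ifs with h3 h4
        · exact le_rfl
        · refine absurd (fun u hu => ?_) h4
          rw [hcb v ⟨hXv, h0⟩, hcX u (hX' v u hXv hu), (hb' v ⟨hXv, h0⟩).2 h3.2.2 u hu]
        · exact Nat.zero_le _
        · exact le_rfl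
      · by_cases hv : ∃ u, G.Adj v u
        · rw [if_neg, zero_add]
          · split_ifs with h3 h4
            · exact le_rfl
            · exact absurd h3.2.2.2 h4
            · exact Nat.zero_le _
            · exact le_rfl
          · rintro ⟨-, h | h, -⟩
            · exact h0 h
            · exact h _ hv.choose_spec
        -- An isolated vertex is happy under every coloring; only the middle sum counts it.
        · rw [if_neg (c := ¬ X v ∧ q v ≠ 0 ∧ _) fun h => hv h.2.2.1, add_zero,
            if_pos (c := ∀ u, G.Adj v u → c u = c v) fun u hu => absurd ⟨u, hu⟩ hv]
          split_ifs <;> omega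

end Vertices
namespace Instance

/-! ### A vertex cover that is found without search -/

variable (I : Instance)

/-- Adjacency, read off the input word. -/
def adjN (x y : ℕ) : Prop := I.word (3 + I.n + (I.n * x + y)) ≠ 0

/-- Precolors, read off the input word. -/
noncomputable def colN (x : ℕ) : ℕ := I.word (3 + x)

@[simp] theorem adjN_coe (u v : Fin I.n) : I.adjN u v ↔ I.G.Adj u v := by
  rw [adjN, word_adj]
  split_ifs with h <;> simp [h]

@[simp] theorem colN_coe (v : Fin I.n) : I.colN v = I.col v := I.word_col v

theorem col_le (v : Fin I.n) : I.col v ≤ I.l := by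
  rw [col]
  cases I.p v with
  | none => exact Nat.zero_le _
  | some j => exact j.2

open Classical in
noncomputable def degN (x : ℕ) : ℕ := ∑ u : Fin I.n, if I.adjN x u then 1 else 0

/-- The vertices of degree more than `t` and their neighbors form a vertex cover together with the
vertices that have a neighbor of degree at most `t`. -/
def coverN (t x : ℕ) : Prop := t < I.degN x ∨ ∃ u : Fin I.n, I.adjN x u ∧ ¬ t < I.degN u

open Classical in
noncomputable def coverSize (t : ℕ) : ℕ := ∑ v : Fin I.n, if I.coverN t v then 1 else 0

open Classical in
/-- The first `t` for which the vertex cover `coverN t` is small in terms of `t`. -/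
noncomputable def threshold : ℕ :=
  iter I.n 0 fun _ x => if I.coverSize x ≤ x * x + x then x else x + 1

/-- An end `v` of degree more than `t` is in the set itself; otherwise the other end has the
neighbor `v` of small degree. -/
theorem coverN_cover (t : ℕ) (u v : Fin I.n) (h : I.G.Adj u v) :
    I.coverN t u ∨ I.coverN t v := by
  by_cases hv : t < I.degN v
  · exact .inr (.inl hv)
  · exact .inl (.inr ⟨v, (I.adjN_coe u v).2 h, hv⟩)

open Classical in
theorem coverSize_eq_card (t : ℕ) :
    I.coverSize t = (Finset.univ.filter fun v : Fin I.n => I.coverN t v).card := by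
  rw [coverSize, Finset.sum_boole, Nat.cast_id]

/-- Let `C` be a minimum vertex cover, of size `d`. A vertex outside `C` has all its neighbors in
`C`, hence degree at most `d`, so it is selected only as a neighbor of some vertex of `C` of degree
at most `d`. There are at most `d * d` such neighbors, besides `C` itself. -/
theorem coverSize_vcNumber_le :
    I.coverSize I.vcNumber ≤ I.vcNumber * I.vcNumber + I.vcNumber := by
  classical
  obtain ⟨C, hC, hcov⟩ := I.G.vertexCoverNum_exists
  have hd : C.toFinset.card = I.vcNumber := by
    rw [vcNumber, ← hC, ← Set.ncard_eq_toFinset_card', Set.ncard_def]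
  have hdeg : ∀ v : Fin I.n, I.degN v = (Finset.univ.filter fun u => I.G.Adj v u).card := by
    intro v
    simp [degN, Finset.sum_boole]
  rw [coverSize_eq_card]
  have hsub : (Finset.univ.filter fun v : Fin I.n => I.coverN I.vcNumber v) ⊆
      C.toFinset ∪ (C.toFinset.filter fun c : Fin I.n => ¬ I.vcNumber < I.degN c).biUnion
        fun c => Finset.univ.filter fun u => I.G.Adj c u := by
    intro v hv
    simp only [Finset.mem_filter, Finset.mem_univ, true_and, Finset.mem_union, Set.mem_toFinset,
      Finset.mem_biUnion] at hv ⊢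
    by_cases hvC : v ∈ C
    · exact .inl hvC
    · have hN : ∀ u, I.G.Adj v u → u ∈ C := fun u h => (hcov h).resolve_left hvC
      rcases hv with hv | ⟨u, hvu, hu⟩
      · exfalso
        rw [hdeg, ← hd] at hv
        refine absurd (Finset.card_le_card fun u hu => ?_) (not_le.2 hv)
        simpa using hN u (by simpa using hu)
      · rw [adjN_coe] at hvu
        exact .inr ⟨u, ⟨hN u hvu, hu⟩, hvu.symm⟩
  refine (Finset.card_le_card hsub).trans ((Finset.card_union_le _ _).trans ?_)
  rw [hd, add_comm]
  refine Nat.add_le_add_right ((Finset.card_biUnion_le_card_mul _ _ I.vcNumber ?_).trans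
    (Nat.mul_le_mul_right _ ((Finset.card_filter_le _ _).trans hd.le))) _
  intro c hc
  rw [← hdeg]
  exact not_lt.1 (Finset.mem_filter.1 hc).2

-- The search cannot step past the vertex cover number, because the size test succeeds there.
open Classical in
theorem threshold_iter (i : ℕ) :
    let x := iter i 0 fun _ x => if I.coverSize x ≤ x * x + x then x else x + 1
    x ≤ i ∧ x ≤ I.vcNumber ∧ (x = i ∨ I.coverSize x ≤ x * x + x) := by
  induction i with
  | zero => simp
  | succ i ih =>
    simp only [iter_succ]
    obtain ⟨h1, h2, h3⟩ := ih
    split_ifs with h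
    · exact ⟨by omega, h2, .inr h⟩
    · refine ⟨by omega, ?_, by omega⟩
      refine lt_of_le_of_ne h2 fun h4 => h ?_
      rw [h4]
      exact I.coverSize_vcNumber_le

theorem coverSize_le_n (t : ℕ) : I.coverSize t ≤ I.n := by
  classical
  rw [coverSize_eq_card]
  exact (Finset.card_filter_le _ _).trans (by simp)

/-- Either the size test succeeded at a threshold at most `d`, or all `n` rounds raised the
threshold; then `n ≤ d`, and the trivial bound `n` is good enough. -/
theorem coverSize_threshold_le :
    I.coverSize I.threshold ≤ I.vcNumber * I.vcNumber + I.vcNumber := by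
  obtain ⟨-, h2, h3⟩ := I.threshold_iter I.n
  rcases h3 with h3 | h3
  · have h4 := I.coverSize_le_n I.threshold
    rw [threshold] at h4 ⊢
    omega
  · rw [threshold]
    exact h3.trans (Nat.add_le_add (Nat.mul_le_mul h2 h2) h2)

/-! ### Functions on the vertex cover as numbers -/

open Classical in
/-- The number of vertices before `x` in the vertex cover. -/
noncomputable def rankN (t x : ℕ) : ℕ :=
  ∑ v : Fin I.n, if (v : ℕ) < x ∧ I.coverN t v then 1 else 0

/-- The digit of `code` in base `b` that belongs to `x`. -/
noncomputable def digit (t b code x : ℕ) : ℕ := code / b ^ I.rankN t x % b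

/-- On the cover `rankN` is injective and below the size of the cover, so it assigns each vertex its
own digit position in base `b`. -/
theorem exists_code (t b : ℕ) (f : Fin I.n → ℕ) (hf : ∀ u : Fin I.n, I.coverN t u → f u < b) :
    ∃ code < b ^ I.coverSize t, ∀ u : Fin I.n, I.coverN t u → I.digit t b code u = f u := by
  classical
  by_cases h0 : ∃ u : Fin I.n, I.coverN t u
  · have hb : 0 < b := by
      obtain ⟨u, hu⟩ := h0
      exact (Nat.zero_le _).trans_lt (hf u hu)
    have hr : ∀ x, I.rankN t x =
        (Finset.univ.filter fun v : Fin I.n => (v : ℕ) < x ∧ I.coverN t v).card := fun x => by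
      rw [rankN, Finset.sum_boole, Nat.cast_id]
    have hmono : ∀ u v : Fin I.n, I.coverN t u → u < v → I.rankN t u < I.rankN t v := by
      intro u v hu huv
      rw [hr, hr]
      refine Finset.card_lt_card (Finset.ssubset_iff_of_subset ?_ |>.2 ⟨u, ?_, ?_⟩)
      · intro w hw
        simp only [Finset.mem_filter, Finset.mem_univ, true_and] at hw ⊢
        exact ⟨hw.1.trans huv, hw.2⟩
      · simpa [hu] using huv
      · simp
    have hlt : ∀ u : Fin I.n, I.coverN t u → I.rankN t u < I.coverSize t := by
      intro u hu
      rw [hr, coverSize_eq_card]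
      refine Finset.card_lt_card (Finset.ssubset_iff_of_subset ?_ |>.2 ⟨u, ?_, ?_⟩)
      · intro w hw
        simp only [Finset.mem_filter, Finset.mem_univ, true_and] at hw ⊢
        exact hw.2
      · simpa using hu
      · simp
    -- The default digit `0` spares a proof that every position is the rank of some vertex.
    let g : Fin (I.coverSize t) → Fin b := fun r =>
      if h : ∃ u : Fin I.n, I.coverN t u ∧ I.rankN t u = r then
        ⟨f h.choose, hf _ h.choose_spec.1⟩ else ⟨0, hb⟩
    refine ⟨finFunctionFinEquiv g, Fin.is_lt _, fun u hu => ?_⟩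
    have hg : (g ⟨I.rankN t u, hlt u hu⟩ : ℕ) = f u := by
      have h : ∃ v : Fin I.n, I.coverN t v ∧ I.rankN t v = I.rankN t u := ⟨u, hu, rfl⟩
      have hch : h.choose = u := by
        rcases lt_trichotomy h.choose u with h1 | h1 | h1
        · exact absurd h.choose_spec.2 (hmono _ _ h.choose_spec.1 h1).ne
        · exact h1
        · exact absurd h.choose_spec.2 (hmono _ _ hu h1).ne'
      simp only [g, dif_pos h, hch]
    rw [← hg]
    conv_rhs => rw [← finFunctionFinEquiv.symm_apply_apply g]
    simp [digit, finFunctionFinEquiv]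
  · push Not at h0
    refine ⟨0, ?_, fun u hu => absurd hu (h0 u)⟩
    have : I.coverSize t = 0 := Finset.sum_eq_zero fun v _ => if_neg (h0 v)
    simp [this]

theorem digit_lt {t b code x : ℕ} (hb : 0 < b) : I.digit t b code x < b := Nat.mod_lt _ hb

/-- Ensures a positive base: every code, not only one built from a labelling, then has digits below
the base on the cover. -/
theorem coverSize_pos {t : ℕ} {u : Fin I.n} (hu : I.coverN t u) : 0 < I.coverSize t := by
  classical
  rw [coverSize_eq_card]
  exact Finset.card_pos.2 ⟨u, by simpa using hu⟩

end Instance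
namespace Expr

/-! ### Expressions about an instance -/

def nE : Expr := get (const 0)
def sumV (b : Expr) : Expr := sumE nE b
def maxV (b : Expr) : Expr := maxE nE b
def exV (b : Expr) : Expr := exE nE b
def allV (b : Expr) : Expr := allE nE b
-- The product of `n` and `a` is a sum over the vertices, so the loop has length `n` whatever `a`
-- is.
def adjE (a b : Expr) : Expr := get (add (add (const 3) nE) (add (sumV (sh a)) b))
def colE (a : Expr) : Expr := get (add (const 3) a)
def degE (a : Expr) : Expr := sumV (oneIf (adjE (sh a) (var 0)))
def ltE (a b : Expr) : Expr := leE (add a (const 1)) b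
def coverE (t a : Expr) : Expr :=
  orE (ltE t (degE a)) (exV (andE (adjE (sh a) (var 0)) (notE (ltE (sh t) (degE (var 0))))))
def sizeE (t : Expr) : Expr := sumV (oneIf (coverE (sh t) (var 0)))
def thresholdE : Expr :=
  fold nE (const 0) (ite (leE (sizeE (var 1)) (add (mulE (var 1) (var 1)) (var 1)))
    (var 1) (add (var 1) (const 1)))
def rankE (t a : Expr) : Expr :=
  sumV (oneIf (andE (ltE (var 0) (sh a)) (coverE (sh t) (var 0))))
def digitE (t b code a : Expr) : Expr := modE (divE code (powE b (rankE t a))) b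

/-- Candidate colors: the color of a vertex, or `1`. -/
def candE (a : Expr) : Expr := ite (colE a) (colE a) (const 1)

/-- Here `ok` and `wt` use variable `0` for the color; variable `1` is to be skipped. -/
def bestE (ok wt : Expr) : Expr :=
  maxV (bind (candE (var 0)) (ite ok (add wt (const 1)) (const 0)))

def edgeOkE (t m code a j : Expr) : Expr :=
  allV (impE (coverE (sh t) (var 0)) (impE (eqE (digitE (sh t) (sh m) (sh code) (var 0)) (sh a))
    (orE (notE (colE (var 0))) (eqE (colE (var 0)) (sh j)))))

def edgeWtE (t m code a j : Expr) : Expr :=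
  sumV (sumV (oneIf (andE (notE (coverE (sh (sh t)) (var 1)))
    (andE (eqE (colE (var 1)) (sh (sh j))) (andE (coverE (sh (sh t)) (var 0))
      (andE (adjE (var 1) (var 0))
        (eqE (digitE (sh (sh t)) (sh (sh m)) (sh (sh code)) (var 0)) (sh (sh a)))))))))

def edgeBestE (t m code a : Expr) : Expr :=
  bestE (edgeOkE (sh (sh t)) (sh (sh m)) (sh (sh code)) (sh (sh a)) (var 0))
    (edgeWtE (sh (sh t)) (sh (sh m)) (sh (sh code)) (sh (sh a)) (var 0))

def edgeScoreE (t m code : Expr) : Expr :=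
  add (sumV (sumV (oneIf (andE (coverE (sh (sh t)) (var 1)) (andE (coverE (sh (sh t)) (var 0))
      (andE (adjE (var 1) (var 0)) (eqE (digitE (sh (sh t)) (sh (sh m)) (sh (sh code)) (var 1))
        (digitE (sh (sh t)) (sh (sh m)) (sh (sh code)) (var 0)))))))))
    (mulE (const 2) (add
      (sumV (ite (andE (notE (coverE (sh t) (var 0))) (notE (colE (var 0))))
        (maxE (sh m) (sumV (oneIf (andE (coverE (sh (sh (sh t))) (var 0))
          (andE (adjE (var 2) (var 0))
            (eqE (digitE (sh (sh (sh t))) (sh (sh (sh m))) (sh (sh (sh code))) (var 0))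
              (var 1)))))))
        (const 0)))
      (sumE m (sub (edgeBestE (sh t) (sh m) (sh code) (var 0)) (const 1)))))

/-- The program for happy edges: in the outer expressions, variable `0` is the size of the vertex
cover and variable `1` the threshold that defines it. -/
def happyEdgesE : Expr :=
  andE (get (const 1)) (bind thresholdE (bind (sizeE (var 0))
    (exE (powE (var 0) (var 0)) (andE
      (allE (var 1) (edgeBestE (var 3) (var 2) (var 1) (var 0)))
      (leE (mulE (const 2) (get (const 2))) (edgeScoreE (var 2) (var 1) (var 0)))))))

def happyE (t h a : Expr) : Expr := andE (coverE t a) (digitE t (const 2) h a)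

def vertexOkE (t m code h : Expr) : Expr :=
  andE
    (allV (allV (impE (happyE (sh (sh t)) (sh (sh h)) (var 1))
      (impE (coverE (sh (sh t)) (var 0)) (impE (adjE (var 1) (var 0))
        (eqE (digitE (sh (sh t)) (sh (sh m)) (sh (sh code)) (var 1))
          (digitE (sh (sh t)) (sh (sh m)) (sh (sh code)) (var 0))))))))
    (allV (allV (allV (impE
      (andE (notE (coverE (sh (sh (sh t))) (var 2))) (notE (colE (var 2))))
      (impE (happyE (sh (sh (sh t))) (sh (sh (sh h))) (var 1))
        (impE (happyE (sh (sh (sh t))) (sh (sh (sh h))) (var 0))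
          (impE (adjE (var 2) (var 1)) (impE (adjE (var 2) (var 0))
            (eqE (digitE (sh (sh (sh t))) (sh (sh (sh m))) (sh (sh (sh code))) (var 1))
              (digitE (sh (sh (sh t))) (sh (sh (sh m))) (sh (sh (sh code))) (var 0)))))))))))

def classOkE (t m code h a j : Expr) : Expr :=
  allV (impE (coverE (sh t) (var 0)) (impE (eqE (digitE (sh t) (sh m) (sh code) (var 0)) (sh a))
    (andE (orE (notE (colE (var 0))) (eqE (colE (var 0)) (sh j)))
      (impE (happyE (sh t) (sh h) (var 0)) (allV (impE (adjE (var 1) (var 0))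
        (orE (notE (colE (var 0))) (eqE (colE (var 0)) (sh (sh j))))))))))

def vertexWtE (t m code a j : Expr) : Expr :=
  sumV (oneIf (andE (notE (coverE (sh t) (var 0))) (andE (eqE (colE (var 0)) (sh j))
    (andE (exV (adjE (var 1) (var 0))) (allV (impE (adjE (var 1) (var 0))
      (eqE (digitE (sh (sh t)) (sh (sh m)) (sh (sh code)) (var 0)) (sh (sh a)))))))))

def vertexBestE (t m code h a : Expr) : Expr :=
  bestE (classOkE (sh (sh t)) (sh (sh m)) (sh (sh code)) (sh (sh h)) (sh (sh a)) (var 0))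
    (vertexWtE (sh (sh t)) (sh (sh m)) (sh (sh code)) (sh (sh a)) (var 0))

def vertexScoreE (t m code h : Expr) : Expr :=
  add (add (sumV (oneIf (happyE (sh t) (sh h) (var 0))))
    (sumV (oneIf (andE (notE (coverE (sh t) (var 0)))
      (andE (orE (notE (colE (var 0))) (allV (notE (adjE (var 1) (var 0)))))
        (allV (allV (impE (adjE (var 2) (var 1)) (impE (adjE (var 2) (var 0))
          (eqE (digitE (sh (sh (sh t))) (sh (sh (sh m))) (sh (sh (sh code))) (var 1))
            (digitE (sh (sh (sh t))) (sh (sh (sh m))) (sh (sh (sh code))) (var 0))))))))))))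
    (sumE m (sub (vertexBestE (sh t) (sh m) (sh code) (sh h) (var 0)) (const 1)))

/-- The program for happy vertices, with variables as in `happyEdgesE`. -/
def happyVerticesE : Expr :=
  andE (get (const 1)) (bind thresholdE (bind (sizeE (var 0))
    (exE (powE (var 0) (var 0)) (exE (powE (const 2) (var 1)) (andE
      (vertexOkE (var 3) (var 2) (var 1) (var 0)) (andE
        (allE (var 2) (vertexBestE (var 4) (var 3) (var 2) (var 1) (var 0)))
        (leE (get (const 2)) (vertexScoreE (var 3) (var 2) (var 1) (var 0)))))))))

/-! ### Values of the expressions -/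

theorem indicator_congr {p q : Prop} {_ : Decidable p} {_ : Decidable q} (h : p ↔ q) :
    (if p then 1 else 0) = if q then 1 else 0 :=
  if_congr h rfl rfl

section
open scoped Classical
variable (I : Instance) (ρ : ℕ → ℕ) (a b t m code h j : Expr)

@[simp] theorem eval_nE : nE.eval I.word ρ = I.n := rfl

@[simp] theorem eval_sumV : (sumV b).eval I.word ρ =
    ∑ v : Fin I.n, b.eval I.word (push v ρ) := by
  rw [sumV, eval_sumE, eval_nE, Finset.sum_range]

@[simp] theorem eval_maxV : (maxV b).eval I.word ρ =
    Finset.univ.sup fun v : Fin I.n => b.eval I.word (push v ρ) := by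
  rw [maxV, eval_maxE, eval_nE]
  refine le_antisymm (Finset.sup_le fun i hi => ?_) (Finset.sup_le fun v _ => ?_)
  · exact Finset.le_sup (f := fun v : Fin I.n => b.eval I.word (push v ρ))
      (Finset.mem_univ ⟨i, Finset.mem_range.1 hi⟩)
  · exact Finset.le_sup (f := fun i => b.eval I.word (push i ρ)) (Finset.mem_range.2 v.2)

@[simp] theorem Holds_exV : (exV b).Holds I.word ρ ↔
    ∃ v : Fin I.n, b.Holds I.word (push v ρ) := by
  simp [exV, Fin.exists_iff]

@[simp] theorem Holds_allV : (allV b).Holds I.word ρ ↔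
    ∀ v : Fin I.n, b.Holds I.word (push v ρ) := by
  simp [allV, Fin.forall_iff]

@[simp] theorem Holds_adjE : (adjE a b).Holds I.word ρ ↔
    I.adjN (a.eval I.word ρ) (b.eval I.word ρ) := by
  simp [adjE, Holds, Instance.adjN]

@[simp] theorem eval_colE : (colE a).eval I.word ρ = I.colN (a.eval I.word ρ) := rfl

@[simp] theorem Holds_colE : (colE a).Holds I.word ρ ↔ I.colN (a.eval I.word ρ) ≠ 0 := Iff.rfl

@[simp] theorem eval_degE : (degE a).eval I.word ρ = I.degN (a.eval I.word ρ) := by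
  simp [degE, Instance.degN]

@[simp] theorem Holds_ltE : (ltE a b).Holds I.word ρ ↔ a.eval I.word ρ < b.eval I.word ρ := by
  simp [ltE]

@[simp] theorem Holds_coverE : (coverE t a).Holds I.word ρ ↔
    I.coverN (t.eval I.word ρ) (a.eval I.word ρ) := by
  simp [coverE, Instance.coverN]

@[simp] theorem eval_sizeE : (sizeE t).eval I.word ρ = I.coverSize (t.eval I.word ρ) := by
  simp [sizeE, Instance.coverSize]

@[simp] theorem eval_thresholdE : thresholdE.eval I.word ρ = I.threshold := by
  rw [thresholdE, eval, Instance.threshold]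
  simp

@[simp] theorem eval_rankE : (rankE t a).eval I.word ρ =
    I.rankN (t.eval I.word ρ) (a.eval I.word ρ) := by
  simp [rankE, Instance.rankN]

@[simp] theorem eval_digitE : (digitE t b code a).eval I.word ρ =
    I.digit (t.eval I.word ρ) (b.eval I.word ρ) (code.eval I.word ρ) (a.eval I.word ρ) := by
  simp [digitE, Instance.digit]

@[simp] theorem eval_candE : (candE a).eval I.word ρ = max (I.colN (a.eval I.word ρ)) 1 := by
  simp only [candE, eval_ite, Holds_colE, eval_colE, eval_const]
  split_ifs <;> omega

@[simp] theorem Holds_edgeOkE : (edgeOkE t m code a j).Holds I.word ρ ↔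
    EdgeOk I.col (fun v => I.coverN (t.eval I.word ρ) v)
      (fun v => I.digit (t.eval I.word ρ) (m.eval I.word ρ) (code.eval I.word ρ) v)
      (a.eval I.word ρ) (j.eval I.word ρ) := by
  simp [edgeOkE, EdgeOk]

@[simp] theorem eval_edgeWtE : (edgeWtE t m code a j).eval I.word ρ =
    edgeWt I.G I.col (fun v => I.coverN (t.eval I.word ρ) v)
      (fun v => I.digit (t.eval I.word ρ) (m.eval I.word ρ) (code.eval I.word ρ) v)
      (a.eval I.word ρ) (j.eval I.word ρ) := by
  simp [edgeWtE, edgeWt]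

@[simp] theorem eval_edgeBestE : (edgeBestE t m code a).eval I.word ρ =
    let X := fun v : Fin I.n => I.coverN (t.eval I.word ρ) v
    let s := fun v : Fin I.n =>
      I.digit (t.eval I.word ρ) (m.eval I.word ρ) (code.eval I.word ρ) v
    best I.col (EdgeOk I.col X s (a.eval I.word ρ)) (edgeWt I.G I.col X s (a.eval I.word ρ)) := by
  simp [edgeBestE, bestE, best]

@[simp] theorem Holds_edgeBestE : (edgeBestE t m code a).Holds I.word ρ ↔
    let X := fun v : Fin I.n => I.coverN (t.eval I.word ρ) v
    let s := fun v : Fin I.n =>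
      I.digit (t.eval I.word ρ) (m.eval I.word ρ) (code.eval I.word ρ) v
    best I.col (EdgeOk I.col X s (a.eval I.word ρ)) (edgeWt I.G I.col X s (a.eval I.word ρ)) ≠ 0 := by
  rw [Holds, eval_edgeBestE]

@[simp] theorem eval_edgeScoreE : (edgeScoreE t m code).eval I.word ρ =
    edgeScore I.G I.col (fun v => I.coverN (t.eval I.word ρ) v)
      (fun v => I.digit (t.eval I.word ρ) (m.eval I.word ρ) (code.eval I.word ρ) v)
      (m.eval I.word ρ) := by
  simp [edgeScoreE, edgeScore]

@[simp] theorem Holds_happyE : (happyE t h a).Holds I.word ρ ↔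
    I.coverN (t.eval I.word ρ) (a.eval I.word ρ) ∧
      I.digit (t.eval I.word ρ) 2 (h.eval I.word ρ) (a.eval I.word ρ) ≠ 0 := by
  rw [happyE, Holds_andE, Holds_coverE, Holds, eval_digitE, eval_const]

@[simp] theorem Holds_vertexOkE : (vertexOkE t m code h).Holds I.word ρ ↔
    VertexOk I.G I.col (fun v => I.coverN (t.eval I.word ρ) v)
      (fun v => I.coverN (t.eval I.word ρ) v ∧
        I.digit (t.eval I.word ρ) 2 (h.eval I.word ρ) v ≠ 0)
      (fun v => I.digit (t.eval I.word ρ) (m.eval I.word ρ) (code.eval I.word ρ) v) := by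
  simp [vertexOkE, VertexOk]

@[simp] theorem Holds_classOkE : (classOkE t m code h a j).Holds I.word ρ ↔
    ClassOk I.G I.col (fun v => I.coverN (t.eval I.word ρ) v)
      (fun v => I.coverN (t.eval I.word ρ) v ∧
        I.digit (t.eval I.word ρ) 2 (h.eval I.word ρ) v ≠ 0)
      (fun v => I.digit (t.eval I.word ρ) (m.eval I.word ρ) (code.eval I.word ρ) v)
      (a.eval I.word ρ) (j.eval I.word ρ) := by
  simp [classOkE, ClassOk]

@[simp] theorem eval_vertexWtE : (vertexWtE t m code a j).eval I.word ρ =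
    vertexWt I.G I.col (fun v => I.coverN (t.eval I.word ρ) v)
      (fun v => I.digit (t.eval I.word ρ) (m.eval I.word ρ) (code.eval I.word ρ) v)
      (a.eval I.word ρ) (j.eval I.word ρ) := by
  simp only [vertexWtE, eval_sumV, eval_oneIf, vertexWt]
  exact Finset.sum_congr rfl fun v _ => indicator_congr (by simp)

@[simp] theorem eval_vertexBestE : (vertexBestE t m code h a).eval I.word ρ =
    let X := fun v : Fin I.n => I.coverN (t.eval I.word ρ) v
    let H := fun v : Fin I.n => I.coverN (t.eval I.word ρ) v ∧
      I.digit (t.eval I.word ρ) 2 (h.eval I.word ρ) v ≠ 0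
    let s := fun v : Fin I.n =>
      I.digit (t.eval I.word ρ) (m.eval I.word ρ) (code.eval I.word ρ) v
    best I.col (ClassOk I.G I.col X H s (a.eval I.word ρ))
      (vertexWt I.G I.col X s (a.eval I.word ρ)) := by
  simp [vertexBestE, bestE, best]

@[simp] theorem Holds_vertexBestE : (vertexBestE t m code h a).Holds I.word ρ ↔
    let X := fun v : Fin I.n => I.coverN (t.eval I.word ρ) v
    let H := fun v : Fin I.n => I.coverN (t.eval I.word ρ) v ∧
      I.digit (t.eval I.word ρ) 2 (h.eval I.word ρ) v ≠ 0
    let s := fun v : Fin I.n =>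
      I.digit (t.eval I.word ρ) (m.eval I.word ρ) (code.eval I.word ρ) v
    best I.col (ClassOk I.G I.col X H s (a.eval I.word ρ))
      (vertexWt I.G I.col X s (a.eval I.word ρ)) ≠ 0 := by
  rw [Holds, eval_vertexBestE]

@[simp] theorem eval_vertexScoreE : (vertexScoreE t m code h).eval I.word ρ =
    vertexScore I.G I.col (fun v => I.coverN (t.eval I.word ρ) v)
      (fun v => I.coverN (t.eval I.word ρ) v ∧
        I.digit (t.eval I.word ρ) 2 (h.eval I.word ρ) v ≠ 0)
      (fun v => I.digit (t.eval I.word ρ) (m.eval I.word ρ) (code.eval I.word ρ) v)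
      (m.eval I.word ρ) := by
  simp only [vertexScoreE, vertexScore, eval_add, eval_sumV, eval_oneIf, eval_sumE, eval_sub]
  refine congrArg₂ _ (congrArg₂ _ ?_ ?_) (by simp)
  · exact Finset.sum_congr rfl fun v _ => indicator_congr (by simp)
  · exact Finset.sum_congr rfl fun v _ => indicator_congr (by simp)

end
end Expr
namespace Expr

/-! ### The lengths of the loops -/

section
variable {I : Instance} {N : ℕ} {ρ : ℕ → ℕ} {a b t m code h j ok wt : Expr}

theorem Bdd_sumV (hN : I.n ≤ N) (hb : ∀ v : Fin I.n, b.Bdd I.word N (push v ρ)) :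
    (sumV b).Bdd I.word N ρ :=
  Bdd_sumE trivial hN fun i hi => hb ⟨i, hi⟩

theorem Bdd_maxV (hN : I.n ≤ N) (hb : ∀ v : Fin I.n, b.Bdd I.word N (push v ρ)) :
    (maxV b).Bdd I.word N ρ :=
  Bdd_maxE trivial hN fun i hi => hb ⟨i, hi⟩

theorem Bdd_exV (hN : I.n ≤ N) (hb : ∀ v : Fin I.n, b.Bdd I.word N (push v ρ)) :
    (exV b).Bdd I.word N ρ :=
  Bdd_exE trivial hN fun i hi => hb ⟨i, hi⟩

theorem Bdd_allV (hN : I.n ≤ N) (hb : ∀ v : Fin I.n, b.Bdd I.word N (push v ρ)) :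
    (allV b).Bdd I.word N ρ :=
  Bdd_allE trivial hN fun i hi => hb ⟨i, hi⟩

theorem Bdd_adjE (hN : I.n ≤ N) (ha : a.Bdd I.word N ρ) (hb : b.Bdd I.word N ρ) :
    (adjE a b).Bdd I.word N ρ :=
  ⟨⟨trivial, trivial⟩, Bdd_sumV hN fun _ => ha, hb⟩

theorem Bdd_colE (ha : a.Bdd I.word N ρ) : (colE a).Bdd I.word N ρ := ⟨trivial, ha⟩

theorem Bdd_degE (hN : I.n ≤ N) (ha : a.Bdd I.word N ρ) : (degE a).Bdd I.word N ρ :=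
  Bdd_sumV hN fun _ => Bdd_oneIf (Bdd_adjE hN ha trivial)

theorem Bdd_ltE (ha : a.Bdd I.word N ρ) (hb : b.Bdd I.word N ρ) : (ltE a b).Bdd I.word N ρ :=
  Bdd_leE ⟨ha, trivial⟩ hb

theorem Bdd_coverE (hN : I.n ≤ N) (ht : t.Bdd I.word N ρ) (ha : a.Bdd I.word N ρ) :
    (coverE t a).Bdd I.word N ρ :=
  Bdd_orE (Bdd_ltE ht (Bdd_degE hN ha)) (Bdd_exV hN fun _ =>
    Bdd_andE (Bdd_adjE hN ha trivial) (Bdd_notE (Bdd_ltE ht (Bdd_degE hN trivial))))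

theorem Bdd_sizeE (hN : I.n ≤ N) (ht : t.Bdd I.word N ρ) : (sizeE t).Bdd I.word N ρ :=
  Bdd_sumV hN fun _ => Bdd_oneIf (Bdd_coverE hN ht trivial)

theorem Bdd_thresholdE (hN : I.n ≤ N) : thresholdE.Bdd I.word N ρ := by
  refine ⟨trivial, trivial, hN, fun i hi => ?_⟩
  simp only [eval_ite, Holds_leE, eval_sizeE, eval_var, push_one, push_zero, eval_add, eval_mulE,
    eval_const]
  have hi' : i < I.n := hi
  -- The square of the accumulator is computed by a loop as long as the accumulator, which is at
  -- most the number of rounds made.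
  have := (I.threshold_iter i).1
  exact Bdd_ite (Bdd_leE (Bdd_sizeE hN trivial) ⟨Bdd_mulE trivial trivial (by
    exact le_trans this (by omega)), trivial⟩) trivial ⟨trivial, trivial⟩

theorem Bdd_rankE (hN : I.n ≤ N) (ht : t.Bdd I.word N ρ) (ha : a.Bdd I.word N ρ) :
    (rankE t a).Bdd I.word N ρ :=
  Bdd_sumV hN fun _ => Bdd_oneIf (Bdd_andE (Bdd_ltE trivial ha) (Bdd_coverE hN ht trivial))

/-- The power of `b` may exceed `N`, but it is never a loop length: the loops run over the base, the
rank, the code and quotients of the code. -/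
theorem Bdd_digitE (hN : I.n ≤ N) (ht : t.Bdd I.word N ρ) (hb : b.Bdd I.word N ρ)
    (hc : code.Bdd I.word N ρ) (ha : a.Bdd I.word N ρ) (hbN : b.eval I.word ρ ≤ N)
    (hcN : code.eval I.word ρ ≤ N) : (digitE t b code a).Bdd I.word N ρ := by
  refine Bdd_modE (Bdd_divE hc (Bdd_powE hb (Bdd_rankE hN ht ha) hbN ?_) hcN) hb ?_
  · rw [eval_rankE]
    classical
    refine le_trans ?_ hN
    rw [Instance.rankN, Finset.sum_boole]
    exact (Finset.card_filter_le _ _).trans (by simp)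
  · rw [eval_divE]
    exact (Nat.div_le_self _ _).trans hcN

theorem Bdd_bestE (hN : I.n ≤ N)
    (hok : ∀ (v : Fin I.n) (x : ℕ), ok.Bdd I.word N (push x (push v ρ)))
    (hwt : ∀ (v : Fin I.n) (x : ℕ), wt.Bdd I.word N (push x (push v ρ))) :
    (bestE ok wt).Bdd I.word N ρ :=
  Bdd_maxV hN fun v => ⟨Bdd_ite (Bdd_colE trivial) (Bdd_colE trivial) trivial,
    Bdd_ite (hok v _) ⟨hwt v _, trivial⟩ trivial⟩

theorem Bdd_edgeBestE (hN : I.n ≤ N) (ht : t.Bdd I.word N ρ) (hm : m.Bdd I.word N ρ)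
    (hc : code.Bdd I.word N ρ) (ha : a.Bdd I.word N ρ) (hmN : m.eval I.word ρ ≤ N)
    (hcN : code.eval I.word ρ ≤ N) : (edgeBestE t m code a).Bdd I.word N ρ :=
  Bdd_bestE hN
    (fun _ _ => Bdd_allV hN fun _ => Bdd_impE (Bdd_coverE hN ht trivial)
      (Bdd_impE (Bdd_eqE (Bdd_digitE hN ht hm hc trivial hmN hcN) ha)
        (Bdd_orE (Bdd_notE (Bdd_colE trivial)) (Bdd_eqE (Bdd_colE trivial) trivial))))
    (fun _ _ => Bdd_sumV hN fun _ => Bdd_sumV hN fun _ => Bdd_oneIf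
      (Bdd_andE (Bdd_notE (Bdd_coverE hN ht trivial)) (Bdd_andE (Bdd_eqE (Bdd_colE trivial) trivial)
        (Bdd_andE (Bdd_coverE hN ht trivial) (Bdd_andE (Bdd_adjE hN trivial trivial)
          (Bdd_eqE (Bdd_digitE hN ht hm hc trivial hmN hcN) ha))))))

theorem Bdd_edgeScoreE (hN : I.n ≤ N) (ht : t.Bdd I.word N ρ) (hm : m.Bdd I.word N ρ)
    (hc : code.Bdd I.word N ρ) (hmN : m.eval I.word ρ ≤ N) (hcN : code.eval I.word ρ ≤ N)
    (h2 : 2 ≤ N) : (edgeScoreE t m code).Bdd I.word N ρ :=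
  ⟨Bdd_sumV hN fun _ => Bdd_sumV hN fun _ => Bdd_oneIf (Bdd_andE (Bdd_coverE hN ht trivial)
      (Bdd_andE (Bdd_coverE hN ht trivial) (Bdd_andE (Bdd_adjE hN trivial trivial)
        (Bdd_eqE (Bdd_digitE hN ht hm hc trivial hmN hcN)
          (Bdd_digitE hN ht hm hc trivial hmN hcN))))),
    Bdd_mulE trivial
      ⟨Bdd_sumV hN fun _ => Bdd_ite (Bdd_andE (Bdd_notE (Bdd_coverE hN ht trivial))
          (Bdd_notE (Bdd_colE trivial)))
        (Bdd_maxE hm hmN fun _ _ => Bdd_sumV hN fun _ => Bdd_oneIf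
          (Bdd_andE (Bdd_coverE hN ht trivial) (Bdd_andE (Bdd_adjE hN trivial trivial)
            (Bdd_eqE (Bdd_digitE hN ht hm hc trivial hmN hcN) trivial)))) trivial,
      Bdd_sumE hm hmN fun _ _ => ⟨Bdd_edgeBestE hN ht hm hc trivial hmN hcN, trivial⟩⟩ h2⟩

theorem Bdd_happyE (hN : I.n ≤ N) (ht : t.Bdd I.word N ρ) (hh : h.Bdd I.word N ρ)
    (ha : a.Bdd I.word N ρ) (h2 : 2 ≤ N) (hhN : h.eval I.word ρ ≤ N) :
    (happyE t h a).Bdd I.word N ρ :=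
  Bdd_andE (Bdd_coverE hN ht ha) (Bdd_digitE hN ht trivial hh ha h2 hhN)

theorem Bdd_vertexOkE (hN : I.n ≤ N) (ht : t.Bdd I.word N ρ) (hm : m.Bdd I.word N ρ)
    (hc : code.Bdd I.word N ρ) (hh : h.Bdd I.word N ρ) (hmN : m.eval I.word ρ ≤ N)
    (hcN : code.eval I.word ρ ≤ N) (h2 : 2 ≤ N) (hhN : h.eval I.word ρ ≤ N) :
    (vertexOkE t m code h).Bdd I.word N ρ :=
  Bdd_andE
    (Bdd_allV hN fun _ => Bdd_allV hN fun _ => Bdd_impE (Bdd_happyE hN ht hh trivial h2 hhN)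
      (Bdd_impE (Bdd_coverE hN ht trivial) (Bdd_impE (Bdd_adjE hN trivial trivial)
        (Bdd_eqE (Bdd_digitE hN ht hm hc trivial hmN hcN)
          (Bdd_digitE hN ht hm hc trivial hmN hcN)))))
    (Bdd_allV hN fun _ => Bdd_allV hN fun _ => Bdd_allV hN fun _ => Bdd_impE
      (Bdd_andE (Bdd_notE (Bdd_coverE hN ht trivial)) (Bdd_notE (Bdd_colE trivial)))
      (Bdd_impE (Bdd_happyE hN ht hh trivial h2 hhN)
        (Bdd_impE (Bdd_happyE hN ht hh trivial h2 hhN) (Bdd_impE (Bdd_adjE hN trivial trivial)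
          (Bdd_impE (Bdd_adjE hN trivial trivial)
            (Bdd_eqE (Bdd_digitE hN ht hm hc trivial hmN hcN)
              (Bdd_digitE hN ht hm hc trivial hmN hcN)))))))

theorem Bdd_vertexBestE (hN : I.n ≤ N) (ht : t.Bdd I.word N ρ) (hm : m.Bdd I.word N ρ)
    (hc : code.Bdd I.word N ρ) (hh : h.Bdd I.word N ρ) (ha : a.Bdd I.word N ρ)
    (hmN : m.eval I.word ρ ≤ N) (hcN : code.eval I.word ρ ≤ N) (h2 : 2 ≤ N)
    (hhN : h.eval I.word ρ ≤ N) : (vertexBestE t m code h a).Bdd I.word N ρ :=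
  Bdd_bestE hN
    (fun _ _ => Bdd_allV hN fun _ => Bdd_impE (Bdd_coverE hN ht trivial)
      (Bdd_impE (Bdd_eqE (Bdd_digitE hN ht hm hc trivial hmN hcN) ha)
        (Bdd_andE
          (Bdd_orE (Bdd_notE (Bdd_colE trivial)) (Bdd_eqE (Bdd_colE trivial) trivial))
          (Bdd_impE (Bdd_happyE hN ht hh trivial h2 hhN) (Bdd_allV hN fun _ =>
            Bdd_impE (Bdd_adjE hN trivial trivial)
              (Bdd_orE (Bdd_notE (Bdd_colE trivial)) (Bdd_eqE (Bdd_colE trivial) trivial)))))))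
    (fun _ _ => Bdd_sumV hN fun _ => Bdd_oneIf
      (Bdd_andE (Bdd_notE (Bdd_coverE hN ht trivial)) (Bdd_andE (Bdd_eqE (Bdd_colE trivial) trivial)
        (Bdd_andE (Bdd_exV hN fun _ => Bdd_adjE hN trivial trivial)
          (Bdd_allV hN fun _ => Bdd_impE (Bdd_adjE hN trivial trivial)
            (Bdd_eqE (Bdd_digitE hN ht hm hc trivial hmN hcN) ha))))))

theorem Bdd_vertexScoreE (hN : I.n ≤ N) (ht : t.Bdd I.word N ρ) (hm : m.Bdd I.word N ρ)
    (hc : code.Bdd I.word N ρ) (hh : h.Bdd I.word N ρ) (hmN : m.eval I.word ρ ≤ N)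
    (hcN : code.eval I.word ρ ≤ N) (h2 : 2 ≤ N) (hhN : h.eval I.word ρ ≤ N) :
    (vertexScoreE t m code h).Bdd I.word N ρ :=
  ⟨⟨Bdd_sumV hN fun _ => Bdd_oneIf (Bdd_happyE hN ht hh trivial h2 hhN),
    Bdd_sumV hN fun _ => Bdd_oneIf (Bdd_andE (Bdd_notE (Bdd_coverE hN ht trivial))
      (Bdd_andE (Bdd_orE (Bdd_notE (Bdd_colE trivial))
          (Bdd_allV hN fun _ => Bdd_notE (Bdd_adjE hN trivial trivial)))
        (Bdd_allV hN fun _ => Bdd_allV hN fun _ => Bdd_impE (Bdd_adjE hN trivial trivial)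
          (Bdd_impE (Bdd_adjE hN trivial trivial)
            (Bdd_eqE (Bdd_digitE hN ht hm hc trivial hmN hcN)
              (Bdd_digitE hN ht hm hc trivial hmN hcN))))))⟩,
    Bdd_sumE hm hmN fun _ _ => ⟨Bdd_vertexBestE hN ht hm hc hh trivial hmN hcN h2 hhN, trivial⟩⟩

theorem Bdd_happyEdgesE (hN : I.n ≤ N) (h2 : 2 ≤ N)
    (hmm : I.coverSize I.threshold ^ I.coverSize I.threshold ≤ N) :
    happyEdgesE.Bdd I.word N ρ := by
  refine Bdd_andE trivial ⟨Bdd_thresholdE hN, Bdd_sizeE hN trivial, ?_⟩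
  simp only [eval_thresholdE, eval_sizeE, eval_var, push_zero]
  have hm := (I.coverSize_le_n I.threshold).trans hN
  refine Bdd_exE (Bdd_powE trivial trivial hm hm) (by simpa using hmm) fun c hc => ?_
  have hc' : c ≤ N := by
    simp only [eval_powE, eval_var, push_zero] at hc
    omega
  exact Bdd_andE
    (Bdd_allE trivial hm fun _ _ => Bdd_edgeBestE hN trivial trivial trivial trivial hm hc')
    (Bdd_leE (Bdd_mulE trivial trivial h2)
      (Bdd_edgeScoreE hN trivial trivial trivial hm hc' h2))

theorem Bdd_happyVerticesE (hN : I.n ≤ N) (h2 : 2 ≤ N)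
    (hmm : I.coverSize I.threshold ^ I.coverSize I.threshold ≤ N)
    (h2m : 2 ^ I.coverSize I.threshold ≤ N) :
    happyVerticesE.Bdd I.word N ρ := by
  refine Bdd_andE trivial ⟨Bdd_thresholdE hN, Bdd_sizeE hN trivial, ?_⟩
  simp only [eval_thresholdE, eval_sizeE, eval_var, push_zero]
  have hm := (I.coverSize_le_n I.threshold).trans hN
  refine Bdd_exE (Bdd_powE trivial trivial hm hm) (by simpa using hmm) fun c hc =>
    Bdd_exE (Bdd_powE trivial trivial h2 hm) (by simpa using h2m) fun x hx => ?_
  have hc' : c ≤ N := by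
    simp only [eval_powE, eval_var, push_zero] at hc
    omega
  have hx' : x ≤ N := by
    simp only [eval_powE, eval_const, eval_var, push_zero, push_one] at hx
    omega
  exact Bdd_andE (Bdd_vertexOkE hN trivial trivial trivial trivial hm hc' h2 hx')
    (Bdd_andE
      (Bdd_allE trivial hm fun _ _ =>
        Bdd_vertexBestE hN trivial trivial trivial trivial trivial hm hc' h2 hx')
      (Bdd_leE trivial (Bdd_vertexScoreE hN trivial trivial trivial trivial hm hc' h2 hx')))

end
end Expr

/-! ### Correctness of the two programs -/

/-- A bound for the number of rounds of a loop, in terms of the vertex cover number. -/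
def loopBound (d : ℕ) : ℕ := (d * d + d + 1) ^ (d * d + d + 1) + 2 ^ (d * d + d)

theorem computable_loopBound : Computable loopBound := by
  have hpow : Primrec₂ fun a b : ℕ => a ^ b := Primrec₂.unpaired'.1 Nat.Primrec.pow
  have hM : Primrec fun d : ℕ => d * d + d :=
    Primrec.nat_add.comp (Primrec.nat_mul.comp .id .id) .id
  exact (Primrec.nat_add.comp (hpow.comp (Primrec.succ.comp hM) (Primrec.succ.comp hM))
    (hpow.comp (Primrec.const 2) hM)).to_comp

namespace Instance
variable (I : Instance)

/-- The cover has at most `d * d + d` vertices. The successor in the base of `loopBound` keeps it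
positive, so that the power is monotone in the exponent. -/
theorem bounds : I.n + 2 ≤ loopBound I.vcNumber * bitLength I.encode ∧
    I.coverSize I.threshold ^ I.coverSize I.threshold ≤
      loopBound I.vcNumber * bitLength I.encode ∧
    2 ^ I.coverSize I.threshold ≤ loopBound I.vcNumber * bitLength I.encode := by
  have h1 := I.n_lt_bitLength
  have h2 := I.coverSize_threshold_le
  have h3 : 1 ≤ loopBound I.vcNumber := by
    have := Nat.one_le_two_pow (n := I.vcNumber * I.vcNumber + I.vcNumber)
    rw [loopBound]
    omega
  have h4 : loopBound I.vcNumber ≤ loopBound I.vcNumber * bitLength I.encode :=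
    Nat.le_mul_of_pos_right _ (by omega)
  refine ⟨h1.le.trans (Nat.le_mul_of_pos_left _ h3), le_trans ?_ h4, le_trans ?_ h4⟩
  · exact ((Nat.pow_le_pow_left (h2.trans (Nat.le_succ _)) _).trans
      (Nat.pow_le_pow_right (Nat.succ_pos _) (h2.trans (Nat.le_succ _)))).trans
      (Nat.le_add_right _ _)
  · exact (Nat.pow_le_pow_right two_pos h2).trans (Nat.le_add_left _ _)

theorem extends_iff (c : Fin I.n → Fin I.l) :
    I.Extends c ↔ ∀ v, I.col v ≠ 0 → (c v : ℕ) + 1 = I.col v := by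
  refine forall_congr' fun v => ?_
  rw [col]
  cases I.p v with
  | none => simp
  | some j =>
    simp only [Option.some.injEq, forall_eq', Option.elim_some, ne_eq, Nat.add_eq_zero_iff,
      one_ne_zero, and_false, not_false_eq_true, forall_const, Nat.add_right_cancel_iff]
    exact Fin.ext_iff

/-- Shifts the colors by one: the combinatorial part uses `1, …, l`, with `0` free to mean not
precolored. -/
theorem exists_coloring {c : Fin I.n → ℕ} (hc : ∀ v, 1 ≤ c v ∧ c v ≤ I.l)
    (hcq : ∀ v, I.col v ≠ 0 → c v = I.col v) :
    ∃ c' : Fin I.n → Fin I.l, I.Extends c' ∧ ∀ u v, c' u = c' v ↔ c u = c v := by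
  refine ⟨fun v => ⟨c v - 1, by have := hc v; omega⟩, ?_, fun u v => ?_⟩
  · rw [extends_iff]
    intro v hv
    have := hc v
    simp only [← hcq v hv]
    omega
  · have := hc u
    have := hc v
    rw [Fin.mk.injEq]
    omega

/-- Combines `exists_labels` with `exists_code`: the search over codes meets every partition of the
cover that comes from a coloring. -/
theorem exists_label_code {C : Type} (c : Fin I.n → C) (t : ℕ) :
    ∃ code < I.coverSize t ^ I.coverSize t, ∀ u v : Fin I.n, I.coverN t u → I.coverN t v →
      (I.digit t (I.coverSize t) code u = I.digit t (I.coverSize t) code v ↔ c u = c v) := by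
  classical
  obtain ⟨s, hs, hsc⟩ := exists_labels (Finset.univ.filter fun v : Fin I.n => I.coverN t v) c
  rw [← coverSize_eq_card] at hs
  simp only [Finset.mem_filter, Finset.mem_univ, true_and] at hs hsc
  obtain ⟨code, h1, h2⟩ := I.exists_code t (I.coverSize t) s hs
  exact ⟨code, h1, fun u v hu hv => by rw [h2 u hu, h2 v hv, hsc u hu v hv]⟩

/-- A successful code yields a coloring by `exists_edgeScore_le`; a good coloring yields the code of
its partition by `edgeScore_ge`. The score counts each edge twice and is therefore compared with `2
* k`. The test `l ≠ 0` is sound, since without colors only the empty graph has a coloring. -/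
theorem happyEdgesE_iff (ρ : ℕ → ℕ) : Expr.happyEdgesE.Holds I.word ρ ↔
    ∃ c : Fin I.n → Fin I.l, I.Extends c ∧ I.k ≤ (happyEdges I.G c).ncard := by
  have hcov := I.coverN_cover I.threshold
  have hlt : ∀ code (u : Fin I.n), I.coverN I.threshold u →
      I.digit I.threshold (I.coverSize I.threshold) code u < I.coverSize I.threshold :=
    fun code u hu => I.digit_lt (I.coverSize_pos hu)
  simp only [Expr.happyEdgesE, Expr.Holds_exE, Expr.Holds_andE, Expr.Holds_allE, Expr.Holds_get,
    Expr.Holds_bind, Expr.Holds_edgeBestE, Expr.Holds_leE, Expr.eval_mulE, Expr.eval_edgeScoreE,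
    Expr.eval_get, Expr.eval_const, Expr.eval_powE, Expr.eval_var, Expr.eval_sizeE,
    Expr.eval_thresholdE, push_zero, push_one, push_two, push_three, word_one, word_two]
  constructor
  · rintro ⟨hl, code, -, hb, hk⟩
    have hl' : 1 ≤ I.l := Nat.one_le_iff_ne_zero.2 hl
    obtain ⟨c, hc, hcq, hle⟩ := exists_edgeScore_le hcov (hlt code) hl' I.col_le hb
    obtain ⟨c', hc', hcc⟩ := I.exists_coloring hc hcq
    refine ⟨c', hc', ?_⟩
    have := two_mul_ncard_happyEdges (G := I.G) c' c hcc
    omega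
  · rintro ⟨c, hc, hk⟩
    -- As `k > 0`, the graph has a vertex; this excludes `l = 0` and makes `best` a maximum over a
    -- nonempty set.
    have hne : Nonempty (Fin I.n) := by
      by_contra h
      rw [not_nonempty_iff] at h
      have h0 : happyEdges I.G c = ∅ := by
        ext e
        induction e with
        | _ u v => exact h.elim u
      rw [h0, Set.ncard_empty] at hk
      exact absurd I.k_pos (by omega)
    have hl : I.l ≠ 0 := by
      obtain ⟨v⟩ := hne
      have := (c v).2
      omega
    obtain ⟨code, hcode, hsc⟩ := I.exists_label_code (fun v => (c v : ℕ) + 1) I.threshold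
    obtain ⟨h1, h2⟩ := edgeScore_ge hcov (hlt code) (q := I.col)
      (fun v => Nat.le_add_left 1 (c v)) ((I.extends_iff c).1 hc) hsc
    refine ⟨hl, code, hcode, h1, ?_⟩
    have := two_mul_ncard_happyEdges (G := I.G) c (fun v => (c v : ℕ) + 1)
      (by simp [Fin.ext_iff])
    omega

theorem happyVerticesE_iff (ρ : ℕ → ℕ) : Expr.happyVerticesE.Holds I.word ρ ↔
    ∃ c : Fin I.n → Fin I.l, I.Extends c ∧ I.k ≤ (happyVertices I.G c).ncard := by
  have hcov := I.coverN_cover I.threshold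
  have hlt : ∀ code (u : Fin I.n), I.coverN I.threshold u →
      I.digit I.threshold (I.coverSize I.threshold) code u < I.coverSize I.threshold :=
    fun code u hu => I.digit_lt (I.coverSize_pos hu)
  have hhappy : ∀ (c : Fin I.n → Fin I.l) (c' : Fin I.n → ℕ),
      (∀ u v, c u = c v ↔ c' u = c' v) → happyVertices I.G c = happyVertices I.G c' := by
    intro c c' h
    ext v
    simp [happyVertices, h]
  simp only [Expr.happyVerticesE, Expr.Holds_exE, Expr.Holds_andE, Expr.Holds_allE,
    Expr.Holds_get, Expr.Holds_bind, Expr.Holds_vertexOkE, Expr.Holds_vertexBestE, Expr.Holds_leE,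
    Expr.eval_vertexScoreE, Expr.eval_get, Expr.eval_const, Expr.eval_powE, Expr.eval_var,
    Expr.eval_sizeE, Expr.eval_thresholdE, push_zero, push_one, push_two, push_three, push_four,
    word_one, word_two]
  constructor
  · rintro ⟨hl, code, -, x, -, hok, hb, hk⟩
    have hl' : 1 ≤ I.l := Nat.one_le_iff_ne_zero.2 hl
    obtain ⟨c, hc, hcq, hle⟩ := exists_vertexScore_le hcov (hlt code) hl' I.col_le
      (fun v hv => hv.1) hok hb
    obtain ⟨c', hc', hcc⟩ := I.exists_coloring hc hcq
    exact ⟨c', hc', hhappy c' c hcc ▸ hk.trans hle⟩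
  · rintro ⟨c, hc, hk⟩
    have hne : Nonempty (Fin I.n) := by
      by_contra h
      rw [not_nonempty_iff] at h
      rw [Set.eq_empty_of_isEmpty (happyVertices I.G c), Set.ncard_empty] at hk
      exact absurd I.k_pos (by omega)
    have hl : I.l ≠ 0 := by
      obtain ⟨v⟩ := hne
      have := (c v).2
      omega
    have hcc : ∀ u v, c u = c v ↔ (c u : ℕ) + 1 = (c v : ℕ) + 1 := by simp [Fin.ext_iff]
    rw [hhappy c (fun v => (c v : ℕ) + 1) hcc] at hk
    obtain ⟨code, hcode, hsc⟩ := I.exists_label_code (fun v => (c v : ℕ) + 1) I.threshold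
    classical
    -- The binary digits of `x` mark the happy vertices of the cover.
    obtain ⟨x, hx, hxH⟩ := I.exists_code I.threshold 2
      (fun v => if ∀ u, I.G.Adj v u → (c u : ℕ) + 1 = (c v : ℕ) + 1 then 1 else 0)
      (fun v _ => by split_ifs <;> omega)
    obtain ⟨h1, h2, h3⟩ := vertexScore_ge hcov (hlt code) (q := I.col)
      (H := fun v => I.coverN I.threshold v ∧ I.digit I.threshold 2 x v ≠ 0)
      (fun v => Nat.le_add_left 1 (c v)) ((I.extends_iff c).1 hc) hsc
      (fun v => and_congr_right fun hv => by
        rw [hxH v hv]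
        split_ifs with h
        · exact iff_of_true one_ne_zero h
        · exact iff_of_false (fun h' => h' rfl) h)
    exact ⟨hl, code, hcode, x, hx, h1, h2, hk.trans h3⟩

end Instance

end HappyColoring

theorem mainTheorem2 :
    HappyColoring.maxHappyVertices.FPT ∧ HappyColoring.maxHappyEdges.FPT := by
  open HappyColoring in
  refine ⟨ParamProblem.fpt_of_expr _ Expr.happyVerticesE loopBound computable_loopBound
    fun I => ?_, ParamProblem.fpt_of_expr _ Expr.happyEdgesE loopBound computable_loopBound
    fun I => ?_⟩
  · obtain ⟨h1, h2, h3⟩ := Instance.bounds I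
    exact ⟨le_trans (by omega) h1,
      Expr.Bdd_happyVerticesE (le_trans (by omega) h1) (le_trans (by omega) h1) h2 h3,
      Instance.happyVerticesE_iff I _⟩
  · obtain ⟨h1, h2, -⟩ := Instance.bounds I
    exact ⟨le_trans (by omega) h1,
      Expr.Bdd_happyEdgesE (le_trans (by omega) h1) (le_trans (by omega) h1) h2,
      Instance.happyEdgesE_iff I _⟩
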